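/- **Uniform Young towers.** Let $(\Delta,\mathcal B,\mu)$ be a probability space partitioned into measurable sets $\Delta_{\alpha,\ell}$, where $\alpha$ ranges over a countable set, $0\le \ell\le \phi(\alpha)-1$ and $\phi(\alpha)\in\{1,2,\dots\}$; put $\Delta_0=\bigcup_\alpha\Delta_{\alpha,0}$. Let $T:\Delta\to\Delta$ be measurable, preserve $\mu$, and send $\Delta_{\alpha,\ell}$ bijectively onto $\Delta_{\alpha,\ell+1}$ if $\ell<\phi(\alpha)-1$, and $\Delta_{\alpha,\phi(\alpha)-1}$ bijectively onto $\Delta_0$; assume that $T$ sends measurable subsets of partition elements to measurable sets. For $x,y\in\Delta$ let $s(x,y)\in\mathbb N\cup\{\infty\}$ be the first $n\geq 0$ such that $T^nx$ and $T^ny$ are not in the same partition element, and, for a fixed $\beta\in(0,1)$, let $d(x,y)=\beta^{s(x,y)}$ (with $\beta^\infty=0$). Then $(\Delta,T,\mu)$ is a *uniform Young tower* if $d$ is a distance (that is, $s(x,y)=\infty$ only if $x=y$), $\gcd\{\phi(\alpha)\}=1$, and there are a constant $C_0$ and a measurable function $g:\Delta\to(0,\infty)$ (the inverse of the Jacobian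 of $T$) such that $\mu(TA)=\int_A g^{-1}\,d\mu$ for every measurable subset $A$ of a partition element, and $|g(x)/g(y)-1|\le C_0\,d(Tx,Ty)$ for all $x,y$ in the same partition element. It has *exponential tails* if $\int_{\Delta_0}e^{c_0\phi}\,d\mu<\infty$ for some $c_0>0$, where $\phi(x)=\phi(\alpha)$ for $x\in\Delta_{\alpha,0}$. **Natural extension.** Let $\Delta_{\mathbb Z}=\{(x_n)_{n\in\mathbb Z}\in\Delta^{\mathbb Z}: x_{n+1}=Tx_n \text{ for all } n\}$ with the $\sigma$-algebra induced by the product $\sigma$-algebra, let $T_{\mathbb Z}((x_n)_n)=(Tx_n)_n$, and let $\mu_{\mathbb Z}$ be the $T_{\mathbb Z}$-invariant measure on $\Delta_{\mathbb Z}$ whose image under $(x_n)_n\mapsto x_0$ is $\mu$. For $x,y\in\Delta_{\mathbb Z}$ let $s_{\mathbb Z}(x,y)=\inf\{|n| : n\in\mathbb Z,\ x_n \text{ and } y_n \text{ are not in the same partition element of } \Delta\}$ and, for a fixed $\beta_{\mathbb Z}\in(0,1)$ (for instance $\beta_{\mathbb Z}=\beta$), let $d_{\mathbb Z}(x,y)=\beta_{\mathbb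 Z}^{s_{\mathbb Z}(x,y)}$. **Theorem.** Let $(\Delta,T,\mu)$ be a uniform Young tower with exponential tails, and let $(\Delta_{\mathbb Z},T_{\mathbb Z},\mu_{\mathbb Z})$ be its natural extension, with the distance $d_{\mathbb Z}$. Then $T_{\mathbb Z}$ satisfies an exponential concentration inequality: there is a constant $C>0$ such that, for every $n\in\mathbb N$ and every function $K:\Delta_{\mathbb Z}^n\to\mathbb R$ that is separately Lipschitz, that is, for all $i\in\{0,\dots,n-1\}$ and all $x_0,\dots,x_{n-1},x_i'\in\Delta_{\mathbb Z}$, $$|K(x_0,\dots,x_i,\dots,x_{n-1})-K(x_0,\dots,x_i',\dots,x_{n-1})|\le \mathrm{Lip}_i(K)\,d_{\mathbb Z}(x_i,x_i')$$ for some constants $\mathrm{Lip}_i(K)$, the functions $K(x,T_{\mathbb Z}x,\dots,T_{\mathbb Z}^{n-1}x)$ and $e^{K(x,T_{\mathbb Z}x,\dots,T_{\mathbb Z}^{n-1}x)}$ are $\mu_{\mathbb Z}$-integrable and $$\int e^{K(x,T_{\mathbb Z}x,\dots,T_{\mathbb Z}^{n-1}x)}\,d\mu_{\mathbb Z}(x)\le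 e^{\int K(x,T_{\mathbb Z}x,\dots,T_{\mathbb Z}^{n-1}x)\,d\mu_{\mathbb Z}(x)}\;e^{C\sum_{i=0}^{n-1}\mathrm{Lip}_i(K)^2}.$$ -/

import Mathlib

open MeasureTheory Set

/-- The distance `β ^ s` attached to a separation time `s`, with `β ^ ∞ = 0`. -/
noncomputable def symbolicDist (β : ℝ) (s : ℕ∞) : ℝ :=
  if s = ⊤ then 0 else β ^ s.toNat

/-- The combinatorics of a Young tower: `Δ` is partitioned into the sets
`Δ_{α,ℓ} = {x | col x = α ∧ ht x = ℓ}`, for `α` in the index set `ι` and `0 ≤ ℓ ≤ φ α - 1`.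
The map `T` sends `Δ_{α,ℓ}` bijectively onto `Δ_{α,ℓ+1}` if `ℓ < φ α - 1`, and
`Δ_{α,φ α - 1}` bijectively onto the basis `Δ_0 = ⋃_α Δ_{α,0}`. -/
structure YoungTower (Δ ι : Type*) where
  T : Δ → Δ
  col : Δ → ι
  ht : Δ → ℕ
  φ : ι → ℕ
  φ_pos : ∀ α, 0 < φ α
  ht_lt : ∀ x, ht x < φ (col x)
  bijOn_succ : ∀ α ℓ, ℓ + 1 < φ α →
    BijOn T {x | col x = α ∧ ht x = ℓ} {x | col x = α ∧ ht x = ℓ + 1}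
  bijOn_top : ∀ α, BijOn T {x | col x = α ∧ ht x = φ α - 1} {x | ht x = 0}

namespace YoungTower

variable {Δ ι : Type*}

/-- The partition element `Δ_{α,ℓ}`. -/
def cell (Y : YoungTower Δ ι) (α : ι) (ℓ : ℕ) : Set Δ := {x | Y.col x = α ∧ Y.ht x = ℓ}

/-- The basis `Δ_0` of the tower. -/
def base (Y : YoungTower Δ ι) : Set Δ := {x | Y.ht x = 0}

/-- Two points are in the same element of the partition. -/
def SameCell (Y : YoungTower Δ ι) (x y : Δ) : Prop := Y.col x = Y.col y ∧ Y.ht x = Y.ht y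

/-- The separation time for the whole dynamics: the first `n` such that `T^n x` and `T^n y` are
not in the same element of the partition (`⊤` if there is none). -/
noncomputable def sepTime (Y : YoungTower Δ ι) (x y : Δ) : ℕ∞ :=
  ⨅ (n : ℕ) (_ : ¬ Y.SameCell (Y.T^[n] x) (Y.T^[n] y)), (n : ℕ∞)

/-- The distance `d(x, y) = β ^ s(x, y)` on the tower. -/
noncomputable def towerDist (Y : YoungTower Δ ι) (β : ℝ) (x y : Δ) : ℝ :=
  symbolicDist β (Y.sepTime x y)

/-- `g` is the inverse of the Jacobian of `T` with respect to `μ`: `μ (T A) = ∫_A 1/g dμ`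
for any measurable subset `A` of an element of the partition. -/
structure IsInverseJacobian [MeasurableSpace Δ] (Y : YoungTower Δ ι) (μ : Measure Δ)
    (g : Δ → ℝ) : Prop where
  measurable : Measurable g
  pos : ∀ x, 0 < g x
  measure_image : ∀ α ℓ, ∀ A ⊆ Y.cell α ℓ, MeasurableSet A →
    μ (Y.T '' A) = ∫⁻ x in A, ENNReal.ofReal (1 / g x) ∂μ

/-- `(Δ, T, μ)`, with the distance `β ^ s`, is a uniform Young tower. -/
structure IsUniform [MeasurableSpace Δ] (Y : YoungTower Δ ι) (μ : Measure Δ) (β : ℝ) : Prop where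
  β_pos : 0 < β
  β_lt_one : β < 1
  /-- `β ^ s` is a distance: it vanishes only for equal points. -/
  eq_of_dist_eq_zero : ∀ x y, Y.towerDist β x y = 0 → x = y
  measurableSet_cell : ∀ α ℓ, MeasurableSet (Y.cell α ℓ)
  measurableSet_image : ∀ α ℓ, ∀ A ⊆ Y.cell α ℓ, MeasurableSet A → MeasurableSet (Y.T '' A)
  isProbabilityMeasure : IsProbabilityMeasure μ
  /-- `T` is measurable and `μ` is invariant. -/
  measurePreserving : MeasurePreserving Y.T μ μ
  distortion : ∃ g : Δ → ℝ, Y.IsInverseJacobian μ g ∧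
    ∃ C : ℝ, ∀ x y, Y.SameCell x y → |g x / g y - 1| ≤ C * Y.towerDist β (Y.T x) (Y.T y)
  /-- The greatest common divisor of the return times is `1`. -/
  aperiodic : ∀ k : ℕ, (∀ α, k ∣ Y.φ α) → k = 1

/-- Exponential tails: `∫_{Δ_0} e^{c₀ φ} dμ < ∞` for some `c₀ > 0`. -/
def HasExponentialTails [MeasurableSpace Δ] (Y : YoungTower Δ ι) (μ : Measure Δ) : Prop :=
  ∃ c₀ : ℝ, 0 < c₀ ∧
    ∫⁻ x in Y.base, ENNReal.ofReal (Real.exp (c₀ * (Y.φ (Y.col x) : ℝ))) ∂μ < ⊤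

/-- The space `Δ_ℤ` of the natural extension: the bi-infinite orbits of `T`. -/
def NatExt (Y : YoungTower Δ ι) : Type _ := {x : ℤ → Δ // ∀ n, x (n + 1) = Y.T (x n)}

/-- `Δ_ℤ` carries the restriction of the product σ-algebra. -/
instance [MeasurableSpace Δ] (Y : YoungTower Δ ι) : MeasurableSpace Y.NatExt :=
  inferInstanceAs (MeasurableSpace {x : ℤ → Δ // ∀ n, x (n + 1) = Y.T (x n)})

/-- The coordinate `x_n` of a point of the natural extension. -/
def coord (Y : YoungTower Δ ι) (n : ℤ) (x : Y.NatExt) : Δ := x.1 n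

/-- The map `T_ℤ : Δ_ℤ → Δ_ℤ`, which applies `T` to each coordinate. -/
def natMap (Y : YoungTower Δ ι) (x : Y.NatExt) : Y.NatExt :=
  ⟨fun n => Y.T (x.1 n), fun n => congrArg Y.T (x.2 n)⟩

/-- `μ_ℤ` is the measure of the natural extension of `(T, μ)`: the (unique) `T_ℤ`-invariant measure
on `Δ_ℤ` that projects to `μ`. -/
structure IsNatExtMeasure [MeasurableSpace Δ] (Y : YoungTower Δ ι) (μ : Measure Δ)
    (μZ : Measure Y.NatExt) : Prop where
  measurePreserving : MeasurePreserving Y.natMap μZ μZ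
  map_coord_zero : μZ.map (Y.coord 0) = μ

/-- The bilateral separation time: the infimum of `|n|`, `n ∈ ℤ`, such that `x_n` and `y_n` are not
in the same element of the partition. -/
noncomputable def bilateralSepTime (Y : YoungTower Δ ι) (x y : Y.NatExt) : ℕ∞ :=
  ⨅ (n : ℤ) (_ : ¬ Y.SameCell (Y.coord n x) (Y.coord n y)), (n.natAbs : ℕ∞)

/-- The distance `d_ℤ(x, y) = β ^ s_ℤ(x, y)` on the natural extension. -/
noncomputable def bilateralDist (Y : YoungTower Δ ι) (β : ℝ) (x y : Y.NatExt) : ℝ :=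
  symbolicDist β (Y.bilateralSepTime x y)

end YoungTower

/-- `K : X^n → ℝ` is separately Lipschitz for the distance `d`, with Lipschitz constant `L i` in
the `i`-th variable. -/
def SeparatelyLipschitz {X : Type*} (d : X → X → ℝ) {n : ℕ} (K : (Fin n → X) → ℝ)
    (L : Fin n → ℝ) : Prop :=
  ∀ (i : Fin n) (x : Fin n → X) (z : X),
    |K x - K (Function.update x i z)| ≤ L i * d (x i) z

/-- The system `(X, T, μ)`, with the distance `d` on `X`, satisfies an exponential concentration
inequality. -/
def ExponentialConcentration {X : Type*} [MeasurableSpace X] (d : X → X → ℝ) (T : X → X)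
    (μ : Measure X) : Prop :=
  ∃ C : ℝ, 0 < C ∧ ∀ (n : ℕ) (K : (Fin n → X) → ℝ) (L : Fin n → ℝ), SeparatelyLipschitz d K L →
    Integrable (fun x => K (fun i => T^[i] x)) μ ∧
    Integrable (fun x => Real.exp (K (fun i => T^[i] x))) μ ∧
    ∫ x, Real.exp (K (fun i => T^[i] x)) ∂μ ≤
      Real.exp (∫ x, K (fun i => T^[i] x) ∂μ) * Real.exp (C * ∑ i, L i ^ 2)

namespace YoungTower

variable {Δ ι : Type*}

/-! ### Inverse branches and separation -/

/-! The core is a reverse-martingale argument of Azuma–Hoeffding type on the one-sided tower. Going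
backward along `T` is a Markov chain with transition weights `w α x`, essentially the inverse
Jacobian at the preimages of `x`. Its averaging operator `avg` preserves `μ`-integrals
(`exists_isBackwardKernel`, `integral_avg`). For a function `F` on the tower, `u p`, the `p`-th
iterate of `avg` on `F`, evaluated at `T^p x`, is the conditional expectation of `F` given `T^p x`.
If `u p` oscillates by at most `A p` over the preimages of each point, then `avg (exp ∘ u p)` is at
most `exp (u (p + 1) + const * A p ^ 2)`. Multiplying these inequalities and letting `p` tend to
infinity, where `u p` tends to `∫ F`, gives concentration, provided `∑ A p ^ 2` is bounded by a
constant times `∑ L j ^ 2`.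

The oscillation bound (`exists_abs_iterate_diag_sub_le`) telescopes `F` over its coordinates `q`,
against a reference point whose orbit merges with the given one after time `p`. Coordinates `q ≥ p`
contribute `L q * θ ^ (q - p)`, because the futures coincide; coordinates `q < p` are damped by the
mixing of `avg` during `p - q` steps. Both contributions are convolutions of `L` with geometric
sequences, hence square summable with the right constant.

Mixing is not uniform: from height `h` the chain first descends deterministically for `h` steps, so
the oscillation grows with the height of the preimage. The exponential tails absorb this in
`avg_exp_le_exp_avg`, which requires the oscillation to be at most linear in the height with a small
slope. This holds for small Lipschitz constants; coordinates with `L j > ε` are frozen, at a cost `L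
j ≤ L j ^ 2 / ε`.

Mixing itself (`exists_gap`) is a Harris-type theorem: a drift inequality for `exp (c * ht)`, a
Doeblin–Fortet inequality for variations, and aperiodicity, which gives any two low points a
positive proportion of preimages close to each other (`exists_small_set`), combine into a
contraction.

Finally, a point of the natural extension is replaced by the forward orbit of its coordinate `-N`,
completed by an artificial past. The error is of order `βZ ^ N`, the law of that coordinate is `μ`,
and the tower estimate has constants independent of `N`. -/

theorem exists_preimage (Y : YoungTower Δ ι) (α : ι) (x : Δ) :
    ∃ y, Y.T y = x ∧ (Y.ht x = 0 → Y.col y = α ∧ Y.ht y = Y.φ α - 1) ∧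
      ∀ h, Y.ht x = h + 1 → Y.col y = Y.col x ∧ Y.ht y = h := by
  rcases Nat.eq_zero_or_eq_succ_pred (Y.ht x) with h0 | h1
  · obtain ⟨y, hy, hyx⟩ := (Y.bijOn_top α).surjOn (show x ∈ {x | Y.ht x = 0} from h0)
    exact ⟨y, hyx, fun _ => hy, fun h hh => by omega⟩
  · have hlt := Y.ht_lt x
    obtain ⟨y, hy, hyx⟩ := (Y.bijOn_succ (Y.col x) (Y.ht x).pred (by omega)).surjOn
      (show x ∈ {z | Y.col z = Y.col x ∧ Y.ht z = (Y.ht x).pred + 1} from ⟨rfl, h1⟩)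
    refine ⟨y, hyx, fun h0 => by omega, fun h hh => ⟨hy.1, ?_⟩⟩
    have := hy.2
    omega

/-- The inverse branch of `T` indexed by `α`: over the basis, the preimage in the top element of
the column `α`; elsewhere, the unique preimage. -/
noncomputable def back (Y : YoungTower Δ ι) (α : ι) (x : Δ) : Δ :=
  (Y.exists_preimage α x).choose

section back

variable (Y : YoungTower Δ ι)

theorem map_back (α : ι) (x : Δ) : Y.T (Y.back α x) = x :=
  (Y.exists_preimage α x).choose_spec.1

theorem col_back_base {x : Δ} (α : ι) (h : Y.ht x = 0) : Y.col (Y.back α x) = α :=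
  ((Y.exists_preimage α x).choose_spec.2.1 h).1

theorem ht_back_base {x : Δ} (α : ι) (h : Y.ht x = 0) : Y.ht (Y.back α x) = Y.φ α - 1 :=
  ((Y.exists_preimage α x).choose_spec.2.1 h).2

theorem col_back_succ {x : Δ} {h : ℕ} (α : ι) (hx : Y.ht x = h + 1) :
    Y.col (Y.back α x) = Y.col x :=
  ((Y.exists_preimage α x).choose_spec.2.2 h hx).1

theorem ht_back_succ {x : Δ} {h : ℕ} (α : ι) (hx : Y.ht x = h + 1) : Y.ht (Y.back α x) = h :=
  ((Y.exists_preimage α x).choose_spec.2.2 h hx).2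

/-- If `y` is not in a top element, its image is not in the basis. -/
theorem col_ht_map_of_lt {y : Δ} (h : Y.ht y + 1 < Y.φ (Y.col y)) :
    Y.col (Y.T y) = Y.col y ∧ Y.ht (Y.T y) = Y.ht y + 1 :=
  (Y.bijOn_succ (Y.col y) (Y.ht y) h).mapsTo ⟨rfl, rfl⟩

theorem ht_map_of_top {y : Δ} (h : Y.ht y = Y.φ (Y.col y) - 1) : Y.ht (Y.T y) = 0 :=
  (Y.bijOn_top (Y.col y)).mapsTo ⟨rfl, h⟩

theorem ht_eq_of_ht_map_eq_zero {y : Δ} (h : Y.ht (Y.T y) = 0) :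
    Y.ht y = Y.φ (Y.col y) - 1 := by
  by_contra hne
  have := Y.ht_lt y
  have := (Y.col_ht_map_of_lt (y := y) (by omega)).2
  omega

theorem ht_map_of_ne_zero {y : Δ} (h : Y.ht (Y.T y) ≠ 0) :
    Y.ht y + 1 < Y.φ (Y.col y) := by
  by_contra hne
  have := Y.ht_lt y
  exact h (Y.ht_map_of_top (by omega))

/-- A point is recovered from its image by the inverse branch of its column. -/
theorem back_col_map (y : Δ) : Y.back (Y.col y) (Y.T y) = y := by
  by_cases h : Y.ht (Y.T y) = 0
  · refine (Y.bijOn_top (Y.col y)).injOn ⟨Y.col_back_base _ h, Y.ht_back_base _ h⟩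
      ⟨rfl, Y.ht_eq_of_ht_map_eq_zero h⟩ (Y.map_back _ _)
  · have hlt := Y.ht_map_of_ne_zero h
    have hm := Y.col_ht_map_of_lt hlt
    exact (Y.bijOn_succ (Y.col y) (Y.ht y) hlt).injOn
      ⟨(Y.col_back_succ _ hm.2).trans hm.1, Y.ht_back_succ _ hm.2⟩ ⟨rfl, rfl⟩ (Y.map_back _ _)

theorem back_eq_of_ht_ne_zero {x : Δ} (h : Y.ht x ≠ 0) (α α' : ι) :
    Y.back α x = Y.back α' x := by
  obtain ⟨k, hk⟩ := Nat.exists_eq_succ_of_ne_zero h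
  have h1 : ∀ γ, Y.back γ x = Y.back (Y.col x) x := fun γ => by
    have := Y.back_col_map (Y.back γ x)
    rwa [Y.map_back, Y.col_back_succ γ hk, eq_comm] at this
  rw [h1 α, h1 α']

theorem back_map_of_ht_ne_zero {y : Δ} (h : Y.ht (Y.T y) ≠ 0) (α : ι) :
    Y.back α (Y.T y) = y := by
  rw [Y.back_eq_of_ht_ne_zero h α (Y.col y), Y.back_col_map]

/-- The points `x` and `y` are in the same elements of the partition during the first `m` steps. -/
def Agree (m : ℕ) (x y : Δ) : Prop := ∀ k < m, Y.SameCell (Y.T^[k] x) (Y.T^[k] y)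

variable {Y}

theorem SameCell.symm {x y : Δ} (h : Y.SameCell x y) : Y.SameCell y x := ⟨h.1.symm, h.2.symm⟩

theorem Agree.symm {m : ℕ} {x y : Δ} (h : Y.Agree m x y) : Y.Agree m y x :=
  fun k hk => (h k hk).symm

theorem Agree.mono {m n : ℕ} {x y : Δ} (h : Y.Agree n x y) (hmn : m ≤ n) : Y.Agree m x y :=
  fun k hk => h k (hk.trans_le hmn)

theorem Agree.sameCell {m : ℕ} {x y : Δ} (h : Y.Agree m x y) (hm : 1 ≤ m) : Y.SameCell x y :=
  h 0 hm

/-- All branches over the basis are full: no agreement of `x` and `y` is needed. This is what makes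
the weights at any two points of the basis comparable. -/
theorem sameCell_back_of_base {x y : Δ} (hx : Y.ht x = 0) (hy : Y.ht y = 0) (α : ι) :
    Y.SameCell (Y.back α x) (Y.back α y) :=
  ⟨by rw [Y.col_back_base α hx, Y.col_back_base α hy],
    by rw [Y.ht_back_base α hx, Y.ht_back_base α hy]⟩

theorem SameCell.back {x y : Δ} (h : Y.SameCell x y) (α : ι) :
    Y.SameCell (Y.back α x) (Y.back α y) := by
  by_cases hx : Y.ht x = 0
  · exact sameCell_back_of_base hx (h.2 ▸ hx) α
  · obtain ⟨k, hk⟩ := Nat.exists_eq_succ_of_ne_zero hx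
    have hk' : Y.ht y = k + 1 := h.2 ▸ hk
    exact ⟨by rw [Y.col_back_succ α hk, Y.col_back_succ α hk', h.1],
      by rw [Y.ht_back_succ α hk, Y.ht_back_succ α hk']⟩

theorem Agree.back_of_sameCell {m : ℕ} {x y : Δ} (h : Y.Agree m x y) {α : ι}
    (h0 : Y.SameCell (Y.back α x) (Y.back α y)) :
    Y.Agree (m + 1) (Y.back α x) (Y.back α y) := by
  intro k hk
  cases k with
  | zero => exact h0
  | succ k =>
    rw [Function.iterate_succ_apply, Function.iterate_succ_apply, Y.map_back, Y.map_back]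
    exact h k (by omega)

theorem Agree.back {m : ℕ} {x y : Δ} (h : Y.Agree m x y) (hm : 1 ≤ m) (α : ι) :
    Y.Agree (m + 1) (Y.back α x) (Y.back α y) :=
  h.back_of_sameCell ((h.sameCell hm).back α)

theorem Agree.back_of_base {m : ℕ} {x y : Δ} (h : Y.Agree m x y) (hx : Y.ht x = 0)
    (hy : Y.ht y = 0) (α : ι) : Y.Agree (m + 1) (Y.back α x) (Y.back α y) :=
  h.back_of_sameCell (sameCell_back_of_base hx hy α)

end back

/-! ### The averaging operator of the backward dynamics -/

/-- Transition weights `w α x` of the backward dynamics, with values summing to `1`, an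
exponentially weak dependence on the future, and exponential tails. -/
structure IsBackwardKernel (Y : YoungTower Δ ι) (w : ι → Δ → ℝ) (θ C c K : ℝ) : Prop where
  θ_pos : 0 < θ
  θ_lt_one : θ < 1
  C_nonneg : 0 ≤ C
  c_pos : 0 < c
  K_nonneg : 0 ≤ K
  nonneg : ∀ α x, 0 ≤ w α x
  hasSum_one : ∀ x, HasSum (fun α => w α x) 1
  distortion : ∀ α m x y, 1 ≤ m → Y.Agree m x y → |w α x - w α y| ≤ C * θ ^ m * w α y
  eq_of_ht_ne_zero : ∀ α x y, Y.ht x ≠ 0 → Y.ht y ≠ 0 → w α x = w α y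
  lower : ∀ α, ∃ κ > 0, ∀ x, κ ≤ w α x
  summable_moment : ∀ x, Y.ht x = 0 → Summable fun α => w α x * Real.exp (c * Y.φ α)
  moment_le : ∀ x, Y.ht x = 0 → ∑' α, w α x * Real.exp (c * Y.φ α) ≤ K

/-- The average of `u` over the preimages of `x`. -/
noncomputable def avg (Y : YoungTower Δ ι) (w : ι → Δ → ℝ) (u : Δ → ℝ) (x : Δ) : ℝ :=
  ∑' α, w α x * u (Y.back α x)

/-- The function `u` grows at most like `exp (c * ht)`. -/
def Adm (Y : YoungTower Δ ι) (c : ℝ) (u : Δ → ℝ) : Prop :=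
  ∃ B : ℝ, ∀ x, |u x| ≤ B * Real.exp (c * Y.ht x)

section avg

variable {Y : YoungTower Δ ι} {w : ι → Δ → ℝ} {θ C c K : ℝ}

theorem Adm.add {u v : Δ → ℝ} (hu : Y.Adm c u) (hv : Y.Adm c v) : Y.Adm c (fun x => u x + v x) := by
  obtain ⟨A, hA⟩ := hu
  obtain ⟨B, hB⟩ := hv
  exact ⟨A + B, fun x => (abs_add_le _ _).trans (by rw [add_mul]; exact add_le_add (hA x) (hB x))⟩

theorem Adm.const_mul {u : Δ → ℝ} (hu : Y.Adm c u) (a : ℝ) : Y.Adm c (fun x => a * u x) := by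
  obtain ⟨A, hA⟩ := hu
  exact ⟨|a| * A, fun x => by
    rw [abs_mul, mul_assoc]; exact mul_le_mul_of_nonneg_left (hA x) (abs_nonneg a)⟩

theorem Adm.sub {u v : Δ → ℝ} (hu : Y.Adm c u) (hv : Y.Adm c v) : Y.Adm c (fun x => u x - v x) := by
  simpa [sub_eq_add_neg] using hu.add (hv.const_mul (-1))

theorem Adm.abs {u : Δ → ℝ} (hu : Y.Adm c u) : Y.Adm c (fun x => |u x|) := by
  obtain ⟨A, hA⟩ := hu
  exact ⟨A, fun x => by rw [abs_abs]; exact hA x⟩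

theorem adm_exp : Y.Adm c (fun x => Real.exp (c * Y.ht x)) :=
  ⟨1, fun x => by rw [abs_of_pos (Real.exp_pos _), one_mul]⟩

theorem one_le_exp_ht (hc : 0 < c) (x : Δ) : 1 ≤ Real.exp (c * Y.ht x) :=
  Real.one_le_exp (by positivity)

theorem adm_of_bounded (hc : 0 < c) {u : Δ → ℝ} {B : ℝ} (h : ∀ x, |u x| ≤ B) : Y.Adm c u :=
  ⟨B, fun x => (h x).trans (le_mul_of_one_le_right ((abs_nonneg _).trans (h x))
    (one_le_exp_ht hc x))⟩

theorem adm_const (hc : 0 < c) (a : ℝ) : Y.Adm c (fun _ => a) :=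
  adm_of_bounded hc (fun _ => le_rfl)

namespace IsBackwardKernel

variable (hw : Y.IsBackwardKernel w θ C c K)
include hw

theorem nonempty_index (x : Δ) : Nonempty ι := by
  by_contra h
  rw [not_nonempty_iff] at h
  have := (hw.hasSum_one x).unique hasSum_empty
  norm_num at this

theorem summable_exp (x : Δ) :
    Summable fun α => w α x * Real.exp (c * Y.ht (Y.back α x)) := by
  by_cases hx : Y.ht x = 0
  · refine Summable.of_nonneg_of_le (fun α => mul_nonneg (hw.nonneg α x) (Real.exp_pos _).le)
      (fun α => mul_le_mul_of_nonneg_left (Real.exp_le_exp.2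
        (mul_le_mul_of_nonneg_left ?_ hw.c_pos.le)) (hw.nonneg α x)) (hw.summable_moment x hx)
    rw [Y.ht_back_base α hx]
    exact_mod_cast Nat.sub_le _ _
  · obtain ⟨k, hk⟩ := Nat.exists_eq_succ_of_ne_zero hx
    simp_rw [fun α => Y.ht_back_succ α hk]
    exact (hw.hasSum_one x).summable.mul_right _

theorem summable {u : Δ → ℝ} (hu : Y.Adm c u) (x : Δ) :
    Summable fun α => w α x * u (Y.back α x) := by
  obtain ⟨B, hB⟩ := hu
  refine Summable.of_norm_bounded ((hw.summable_exp x).mul_left B) fun α => ?_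
  rw [Real.norm_eq_abs, abs_mul, abs_of_nonneg (hw.nonneg α x), mul_left_comm]
  exact mul_le_mul_of_nonneg_left (hB _) (hw.nonneg α x)

theorem avg_mono {u v : Δ → ℝ} (hu : Y.Adm c u) (hv : Y.Adm c v) {x : Δ}
    (h : ∀ α, u (Y.back α x) ≤ v (Y.back α x)) : Y.avg w u x ≤ Y.avg w v x :=
  (hw.summable hu x).tsum_le_tsum (fun α => mul_le_mul_of_nonneg_left (h α) (hw.nonneg α x))
    (hw.summable hv x)

theorem avg_add {u v : Δ → ℝ} (hu : Y.Adm c u) (hv : Y.Adm c v) (x : Δ) :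
    Y.avg w (fun x => u x + v x) x = Y.avg w u x + Y.avg w v x := by
  simp only [avg, mul_add]
  exact (hw.summable hu x).tsum_add (hw.summable hv x)

omit hw in
theorem avg_const_mul (u : Δ → ℝ) (a : ℝ) (x : Δ) :
    Y.avg w (fun x => a * u x) x = a * Y.avg w u x := by
  simp only [avg, mul_left_comm _ a]
  exact tsum_mul_left

theorem avg_sub {u v : Δ → ℝ} (hu : Y.Adm c u) (hv : Y.Adm c v) (x : Δ) :
    Y.avg w (fun x => u x - v x) x = Y.avg w u x - Y.avg w v x := by
  simp only [avg, mul_sub]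
  exact (hw.summable hu x).tsum_sub (hw.summable hv x)

theorem avg_const (a : ℝ) (x : Δ) : Y.avg w (fun _ => a) x = a := by
  simp only [avg]
  rw [tsum_mul_right, (hw.hasSum_one x).tsum_eq, one_mul]

/-- Above the basis the backward chain is deterministic, so all randomness enters at height `0`. -/
theorem avg_of_ht_ne_zero {x : Δ} (hx : Y.ht x ≠ 0) (u : Δ → ℝ) (α : ι) :
    Y.avg w u x = u (Y.back α x) := by
  simp only [avg, fun γ => Y.back_eq_of_ht_ne_zero hx γ α]
  rw [tsum_mul_right, (hw.hasSum_one x).tsum_eq, one_mul]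

theorem avg_exp_base_le {x : Δ} (hx : Y.ht x = 0) :
    Y.avg w (fun x => Real.exp (c * Y.ht x)) x ≤ K := by
  refine le_trans ((hw.summable_exp x).tsum_le_tsum (fun α => mul_le_mul_of_nonneg_left
    (Real.exp_le_exp.2 (mul_le_mul_of_nonneg_left ?_ hw.c_pos.le)) (hw.nonneg α x))
    (hw.summable_moment x hx)) (hw.moment_le x hx)
  rw [Y.ht_back_base α hx]
  exact_mod_cast Nat.sub_le _ _

/-- Foster–Lyapunov drift: a step above the basis lowers the height by one, and a jump from the
basis costs at most the exponential moment `K`. -/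
theorem avg_exp_le (x : Δ) : Y.avg w (fun x => Real.exp (c * Y.ht x)) x ≤
    Real.exp (-c) * Real.exp (c * Y.ht x) + K := by
  by_cases hx : Y.ht x = 0
  · exact (hw.avg_exp_base_le hx).trans (le_add_of_nonneg_left (by positivity))
  · obtain ⟨α⟩ := hw.nonempty_index x
    obtain ⟨k, hk⟩ := Nat.exists_eq_succ_of_ne_zero hx
    rw [hw.avg_of_ht_ne_zero hx _ α, Y.ht_back_succ α hk, hk, ← Real.exp_add]
    refine le_trans (Real.exp_le_exp.2 (le_of_eq ?_)) (le_add_of_nonneg_right hw.K_nonneg)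
    push_cast
    ring

theorem abs_avg_le {u : Δ → ℝ} (hu : Y.Adm c u) (x : Δ) :
    |Y.avg w u x| ≤ Y.avg w (fun x => |u x|) x := by
  rw [abs_le]
  constructor
  · have := hw.avg_mono (hu.abs.const_mul (-1)) hu (x := x) (fun α => by
      have := neg_abs_le (u (Y.back α x)); linarith)
    rw [avg_const_mul] at this
    linarith
  · exact hw.avg_mono hu hu.abs (fun α => le_abs_self _)

theorem adm_avg {u : Δ → ℝ} (hu : Y.Adm c u) : Y.Adm c (Y.avg w u) := by
  have hu' := hu
  obtain ⟨B, hB⟩ := hu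
  refine ⟨|B| * (Real.exp (-c) + K), fun x => ?_⟩
  calc |Y.avg w u x| ≤ Y.avg w (fun x => |u x|) x := hw.abs_avg_le hu' x
    _ ≤ Y.avg w (fun x => |B| * Real.exp (c * Y.ht x)) x :=
        hw.avg_mono hu'.abs (adm_exp.const_mul _) fun α => (hB _).trans
          (mul_le_mul_of_nonneg_right (le_abs_self B) (Real.exp_pos _).le)
    _ ≤ |B| * (Real.exp (-c) * Real.exp (c * Y.ht x) + K) := by
        rw [avg_const_mul]
        exact mul_le_mul_of_nonneg_left (hw.avg_exp_le x) (abs_nonneg B)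
    _ ≤ |B| * (Real.exp (-c) + K) * Real.exp (c * Y.ht x) := by
        rw [mul_assoc, add_mul]
        refine mul_le_mul_of_nonneg_left (add_le_add le_rfl ?_) (abs_nonneg B)
        exact le_mul_of_one_le_right hw.K_nonneg (one_le_exp_ht hw.c_pos x)

theorem adm_iterate {u : Δ → ℝ} (hu : Y.Adm c u) (n : ℕ) : Y.Adm c ((Y.avg w)^[n] u) := by
  induction n with
  | zero => exact hu
  | succ n ih => rw [Function.iterate_succ_apply']; exact hw.adm_avg ih

theorem iterate_const (a : ℝ) (n : ℕ) : (Y.avg w)^[n] (fun _ => a) = fun _ => a := by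
  induction n with
  | zero => rfl
  | succ n ih => rw [Function.iterate_succ_apply', ih]; exact funext (hw.avg_const a)

theorem iterate_add {u v : Δ → ℝ} (hu : Y.Adm c u) (hv : Y.Adm c v) (n : ℕ) :
    (Y.avg w)^[n] (fun x => u x + v x) =
      fun x => (Y.avg w)^[n] u x + (Y.avg w)^[n] v x := by
  induction n with
  | zero => rfl
  | succ n ih =>
    simp only [Function.iterate_succ_apply', ih]
    exact funext (hw.avg_add (hw.adm_iterate hu n) (hw.adm_iterate hv n))

omit hw in
theorem iterate_const_mul (u : Δ → ℝ) (a : ℝ) (n : ℕ) :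
    (Y.avg w)^[n] (fun x => a * u x) = fun x => a * (Y.avg w)^[n] u x := by
  induction n with
  | zero => rfl
  | succ n ih =>
    simp only [Function.iterate_succ_apply', ih]
    exact funext (avg_const_mul _ a)

theorem iterate_sub {u v : Δ → ℝ} (hu : Y.Adm c u) (hv : Y.Adm c v) (n : ℕ) :
    (Y.avg w)^[n] (fun x => u x - v x) =
      fun x => (Y.avg w)^[n] u x - (Y.avg w)^[n] v x := by
  induction n with
  | zero => rfl
  | succ n ih =>
    simp only [Function.iterate_succ_apply', ih]
    exact funext (hw.avg_sub (hw.adm_iterate hu n) (hw.adm_iterate hv n))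

theorem iterate_sum {κ : Type*} (s : Finset κ) {u : κ → Δ → ℝ} (hu : ∀ q, Y.Adm c (u q)) (n : ℕ) :
    (Y.avg w)^[n] (fun x => ∑ q ∈ s, u q x) = fun x => ∑ q ∈ s, (Y.avg w)^[n] (u q) x := by
  classical
  have hs : ∀ s : Finset κ, Y.Adm c (fun x => ∑ q ∈ s, u q x) := fun s => by
    induction s using Finset.induction_on with
    | empty => simpa using adm_const hw.c_pos 0
    | insert a s ha ih => simpa [Finset.sum_insert ha] using (hu a).add ih
  induction s using Finset.induction_on with
  | empty => simpa using hw.iterate_const 0 n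
  | insert a s ha ih =>
    simp only [Finset.sum_insert ha]
    rw [hw.iterate_add (hu a) (hs s), ih]

theorem iterate_mono {u v : Δ → ℝ} (hu : Y.Adm c u) (hv : Y.Adm c v) (h : ∀ x, u x ≤ v x) (n : ℕ)
    (x : Δ) : (Y.avg w)^[n] u x ≤ (Y.avg w)^[n] v x := by
  induction n generalizing x with
  | zero => exact h x
  | succ n ih =>
    simp only [Function.iterate_succ_apply']
    exact hw.avg_mono (hw.adm_iterate hu n) (hw.adm_iterate hv n) fun α => ih _

theorem abs_iterate_le {u : Δ → ℝ} (hu : Y.Adm c u) (n : ℕ) (x : Δ) :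
    |(Y.avg w)^[n] u x| ≤ (Y.avg w)^[n] (fun x => |u x|) x := by
  induction n generalizing x with
  | zero => exact le_rfl
  | succ n ih =>
    simp only [Function.iterate_succ_apply']
    exact (hw.abs_avg_le (hw.adm_iterate hu n) x).trans
      (hw.avg_mono (hw.adm_iterate hu n).abs (hw.adm_iterate hu.abs n) fun α => ih _)

/-- A bound for `u` on the preimages of order `n` of `x` carries over to the average. -/
theorem abs_iterate_le_of_forall {u : Δ → ℝ} (hu : Y.Adm c u) {B : ℝ} (n : ℕ) {x : Δ}
    (h : ∀ z, Y.T^[n] z = x → |u z| ≤ B) : |(Y.avg w)^[n] u x| ≤ B := by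
  induction n generalizing x with
  | zero => exact h x rfl
  | succ n ih =>
    simp only [Function.iterate_succ_apply']
    refine (hw.abs_avg_le (hw.adm_iterate hu n) x).trans ?_
    rw [← hw.avg_const B x]
    refine hw.avg_mono (hw.adm_iterate hu n).abs (adm_const hw.c_pos B) fun α => ih fun z hz => h z ?_
    rw [Function.iterate_succ_apply', hz, Y.map_back]

/-- Uniform bound for the iterates of the Lyapunov function `exp (c * ht)`. -/
theorem iterate_exp_le (n : ℕ) (x : Δ) : (Y.avg w)^[n] (fun x => Real.exp (c * Y.ht x)) x ≤
    Real.exp (-c) ^ n * Real.exp (c * Y.ht x) + K / (1 - Real.exp (-c)) := by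
  have hq : Real.exp (-c) < 1 := by rw [Real.exp_lt_one_iff]; linarith [hw.c_pos]
  have key : (Y.avg w)^[n] (fun x => Real.exp (c * Y.ht x)) x ≤
      Real.exp (-c) ^ n * Real.exp (c * Y.ht x) + K * ∑ i ∈ Finset.range n, Real.exp (-c) ^ i := by
    induction n generalizing x with
    | zero => simp
    | succ n ih =>
      rw [Function.iterate_succ_apply']
      calc _ ≤ Y.avg w (fun x => Real.exp (-c) ^ n * Real.exp (c * Y.ht x) +
            K * ∑ i ∈ Finset.range n, Real.exp (-c) ^ i) x := hw.avg_mono (hw.adm_iterate adm_exp n)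
              ((adm_exp.const_mul _).add (adm_const hw.c_pos _)) fun α => ih _
        _ = Real.exp (-c) ^ n * Y.avg w (fun x => Real.exp (c * Y.ht x)) x +
            K * ∑ i ∈ Finset.range n, Real.exp (-c) ^ i := by
          rw [hw.avg_add (adm_exp.const_mul _) (adm_const hw.c_pos _), avg_const_mul, hw.avg_const]
        _ ≤ _ := by
          rw [Finset.sum_range_succ]
          have := mul_le_mul_of_nonneg_left (hw.avg_exp_le x) (pow_pos (Real.exp_pos (-c)) n).le
          rw [pow_succ]
          linarith
  refine key.trans (add_le_add le_rfl ?_)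
  rw [div_eq_mul_inv]
  refine mul_le_mul_of_nonneg_left ?_ hw.K_nonneg
  rw [← tsum_geometric_of_lt_one (Real.exp_pos _).le hq]
  exact (summable_geometric_of_lt_one (Real.exp_pos _).le hq).sum_le_tsum _
    fun i _ => (pow_pos (Real.exp_pos _) i).le

end IsBackwardKernel

end avg

/-! ### Words of inverse branches -/

section words

variable (Y : YoungTower Δ ι)

/-- The composition of the inverse branches indexed by a list. -/
noncomputable def backWord (Y : YoungTower Δ ι) : List ι → Δ → Δ
  | [], x => x
  | α :: l, x => backWord Y l (Y.back α x)

theorem backWord_append (l l' : List ι) (x : Δ) :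
    Y.backWord (l ++ l') x = Y.backWord l' (Y.backWord l x) := by
  induction l generalizing x with
  | nil => rfl
  | cons α l ih => exact ih _

theorem ht_backWord (l : List ι) {x : Δ} (h : l.length = Y.ht x) : Y.ht (Y.backWord l x) = 0 := by
  induction l generalizing x with
  | nil => exact h.symm
  | cons α l ih => exact ih (Y.ht_back_succ α h.symm).symm

variable {Y}

theorem Agree.backWord {m : ℕ} {x y : Δ} (h : Y.Agree m x y) (hm : 1 ≤ m) (l : List ι) :
    Y.Agree (m + l.length) (Y.backWord l x) (Y.backWord l y) := by
  induction l generalizing m x y with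
  | nil => exact h
  | cons α l ih => exact (ih (h.back hm α) (by omega)).mono (by simp only [List.length_cons]; omega)

theorem agree_backWord_of_base {x y : Δ} (hx : Y.ht x = 0) (hy : Y.ht y = 0) (l : List ι) :
    Y.Agree l.length (Y.backWord l x) (Y.backWord l y) := by
  cases l with
  | nil => exact fun k hk => absurd hk (Nat.not_lt_zero k)
  | cons α l =>
    have h0 : Y.Agree 0 x y := fun k hk => absurd hk (Nat.not_lt_zero k)
    exact ((h0.back_of_base hx hy α).backWord le_rfl l).mono (by simp only [List.length_cons]; omega)

/-- By aperiodicity, any long enough time is the duration of a return of the basis to itself. -/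
theorem exists_return_words (hap : ∀ k : ℕ, (∀ α, k ∣ Y.φ α) → k = 1) :
    ∃ N, ∀ n ≥ N, ∃ l : List ι, l.length = n ∧ ∀ x, Y.ht x = 0 → Y.ht (Y.backWord l x) = 0 := by
  have hg : Nat.setGcd (range Y.φ) = 1 :=
    hap _ fun α => Nat.setGcd_dvd_of_mem (mem_range_self α)
  -- The additive semigroup generated by the return times contains all large multiples of their gcd,
  -- which is `1`.
  obtain ⟨N, hN⟩ := Nat.exists_mem_closure_of_ge (range Y.φ)
  suffices h : ∀ n ∈ AddSubmonoid.closure (range Y.φ), ∃ l : List ι, l.length = n ∧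
      ∀ x, Y.ht x = 0 → Y.ht (Y.backWord l x) = 0 from
    ⟨N, fun n hn => h n (hN n hn (by rw [hg]; exact one_dvd n))⟩
  intro n hmem
  induction hmem using AddSubmonoid.closure_induction with
  | mem k hk =>
    obtain ⟨α, rfl⟩ := hk
    obtain ⟨j, hj⟩ := Nat.exists_eq_succ_of_ne_zero (Y.φ_pos α).ne'
    -- The first letter jumps to the top of column `α`; the remaining `φ α - 1` letters only descend
    -- to its bottom.
    refine ⟨List.replicate (Y.φ α) α, List.length_replicate, fun x hx => ?_⟩
    rw [hj, List.replicate_succ, backWord]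
    refine Y.ht_backWord _ ?_
    rw [List.length_replicate, Y.ht_back_base α hx, hj]
    rfl
  | zero => exact ⟨[], rfl, fun x hx => hx⟩
  | add a b _ _ ha hb =>
    obtain ⟨l, hl, hl0⟩ := ha
    obtain ⟨l', hl', hl0'⟩ := hb
    refine ⟨l ++ l', by rw [List.length_append, hl, hl'], fun x hx => ?_⟩
    rw [backWord_append]
    exact hl0' _ (hl0 _ hx)

end words

/-! ### Doeblin–Fortet inequality and the coupling of low points -/

section avg

variable {Y : YoungTower Δ ι} {w : ι → Δ → ℝ} {θ C c K : ℝ}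

/-- The variations of `f` decay like `θ ^ m` with the agreement time. -/
def Lip (Y : YoungTower Δ ι) (θ ℓ : ℝ) (f : Δ → ℝ) : Prop :=
  ∀ m x y, 1 ≤ m → Y.Agree m x y → |f x - f y| ≤ ℓ * θ ^ m

namespace IsBackwardKernel

variable (hw : Y.IsBackwardKernel w θ C c K)
include hw

theorem exists_base_point (x : Δ) :
    ∃ y, Y.ht y = 0 ∧ ∀ m u, (Y.avg w)^[m + Y.ht x] u x = (Y.avg w)^[m] u y := by
  induction h : Y.ht x generalizing x with
  | zero => exact ⟨x, h, fun m u => rfl⟩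
  | succ k ih =>
    obtain ⟨α⟩ := hw.nonempty_index x
    obtain ⟨y, hy, hyu⟩ := ih (Y.back α x) (Y.ht_back_succ α h)
    refine ⟨y, hy, fun m u => ?_⟩
    rw [← hyu, ← add_assoc, Function.iterate_succ_apply', hw.avg_of_ht_ne_zero (by omega) _ α]

/-- A positive proportion of the preimages of `x` is concentrated on any given branch. -/
theorem le_iterate_backWord {κ : ι → ℝ} (hκ : ∀ α, 0 < κ α) (hκw : ∀ α x, κ α ≤ w α x)
    {f : Δ → ℝ} (hf : Y.Adm c f) (hf0 : ∀ x, 0 ≤ f x) (l : List ι) (x : Δ) :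
    (l.map κ).prod * f (Y.backWord l x) ≤ (Y.avg w)^[l.length] f x := by
  have hpos : ∀ n x, 0 ≤ (Y.avg w)^[n] f x := fun n x => by
    have := hw.iterate_mono (adm_const hw.c_pos 0) hf hf0 n x
    rwa [hw.iterate_const] at this
  induction l generalizing x with
  | nil => simp [backWord]
  | cons α l ih =>
    rw [List.length_cons, Function.iterate_succ_apply', List.map_cons, List.prod_cons, mul_assoc]
    calc _ ≤ κ α * (Y.avg w)^[l.length] f (Y.back α x) :=
          mul_le_mul_of_nonneg_left (ih _) (hκ α).le
      _ ≤ w α x * (Y.avg w)^[l.length] f (Y.back α x) :=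
          mul_le_mul_of_nonneg_right (hκw α x) (hpos _ _)
      _ ≤ _ := (hw.summable (hw.adm_iterate hf _) x).le_tsum α
          fun γ _ => mul_nonneg (hw.nonneg γ x) (hpos _ _)

/-- Variations of the iterates of the averaging operator. -/
theorem abs_iterate_sub_le {f : Δ → ℝ} (hf : Y.Adm c f) {E : ℕ → ℝ} {a M : ℝ} (hM0 : 0 ≤ M)
    (hE : ∀ k x y, 1 ≤ k → Y.Agree k x y → |f x - f y| ≤ E k)
    (hM : ∀ j y, Y.ht y = 0 → Y.avg w (fun z => |(Y.avg w)^[j] f z - a|) y ≤ M)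
    (j m : ℕ) (x y : Δ) (hm : 1 ≤ m) (hxy : Y.Agree m x y) :
    |(Y.avg w)^[j] f x - (Y.avg w)^[j] f y| ≤
      E (j + m) + C * M * θ ^ m * ∑ i ∈ Finset.range j, θ ^ i := by
  induction j generalizing m x y with
  | zero => simpa using hE m x y hm hxy
  | succ j ih =>
    set u := (Y.avg w)^[j] f with hu
    have hua : Y.Adm c u := hw.adm_iterate hf j
    set B := E (j + (m + 1)) + C * M * θ ^ (m + 1) * ∑ i ∈ Finset.range j, θ ^ i with hB
    have hbr : ∀ α, |u (Y.back α x) - u (Y.back α y)| ≤ B := fun α =>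
      ih (m + 1) _ _ (by omega) (hxy.back hm α)
    have hCM : 0 ≤ C * M * θ ^ m := mul_nonneg (mul_nonneg hw.C_nonneg hM0) (pow_nonneg hw.θ_pos.le m)
    have hgoal : E (j + 1 + m) + C * M * θ ^ m * ∑ i ∈ Finset.range (j + 1), θ ^ i =
        B + C * M * θ ^ m := by
      rw [Finset.sum_range_succ', hB, show j + (m + 1) = j + 1 + m by ring]
      simp only [pow_succ, ← Finset.sum_mul]
      ring
    rw [Function.iterate_succ_apply', ← hu, hgoal]
    by_cases hx : Y.ht x = 0
    · have hy : Y.ht y = 0 := (hxy.sameCell hm).2 ▸ hx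
      have hg : HasSum (fun α => w α x * B + C * θ ^ m * (w α y * |u (Y.back α y) - a|))
          (1 * B + C * θ ^ m * Y.avg w (fun z => |u z - a|) y) :=
        ((hw.hasSum_one x).mul_right B).add
          ((hw.summable (hua.sub (adm_const hw.c_pos a)).abs y).hasSum.mul_left _)
      have h1 := (hw.summable hua x).hasSum
      have h2 := (hw.summable hua y).hasSum
      -- The weights at `x` and at `y` have the same sum, so subtracting `a` times their difference
      -- changes nothing. Only the deviation of `u` from `a` is then multiplied by the distortion of
      -- the weights.
      have h3 := ((h1.sub h2).sub (((hw.hasSum_one x).sub (hw.hasSum_one y)).mul_left a))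
      have h4 := tsum_of_norm_bounded (f := fun α => w α x * u (Y.back α x) -
        w α y * u (Y.back α y) - a * (w α x - w α y)) hg fun α => by
          rw [Real.norm_eq_abs, show w α x * u (Y.back α x) - w α y * u (Y.back α y) -
            a * (w α x - w α y) = w α x * (u (Y.back α x) - u (Y.back α y)) +
            (w α x - w α y) * (u (Y.back α y) - a) by ring]
          refine (abs_add_le _ _).trans (add_le_add ?_ ?_)
          · rw [abs_mul, abs_of_nonneg (hw.nonneg α x)]
            exact mul_le_mul_of_nonneg_left (hbr α) (hw.nonneg α x)
          · rw [abs_mul, ← mul_assoc]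
            exact mul_le_mul_of_nonneg_right (hw.distortion α m x y hm hxy) (abs_nonneg _)
      rw [h3.tsum_eq, Real.norm_eq_abs, sub_self, mul_zero, sub_zero] at h4
      refine h4.trans ?_
      rw [one_mul]
      have := mul_le_mul_of_nonneg_left (hM j y hy)
        (mul_nonneg hw.C_nonneg (pow_nonneg hw.θ_pos.le m))
      linarith
    · have hy : Y.ht y ≠ 0 := (hxy.sameCell hm).2 ▸ hx
      obtain ⟨α⟩ := hw.nonempty_index x
      rw [hw.avg_of_ht_ne_zero hx u α, hw.avg_of_ht_ne_zero hy u α]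
      linarith [hbr α]

theorem sum_pow_le (j : ℕ) : ∑ i ∈ Finset.range j, θ ^ i ≤ (1 - θ)⁻¹ := by
  rw [← tsum_geometric_of_lt_one hw.θ_pos.le hw.θ_lt_one]
  exact (summable_geometric_of_lt_one hw.θ_pos.le hw.θ_lt_one).sum_le_tsum _
    fun i _ => (pow_pos hw.θ_pos i).le

/-- Variations of the iterates for a bounded function. -/
theorem abs_iterate_sub_le_of_bounded {f : Δ → ℝ} {E : ℕ → ℝ} {M : ℝ} (hM0 : 0 ≤ M)
    (hf : ∀ x, |f x| ≤ M) (hE : ∀ k x y, 1 ≤ k → Y.Agree k x y → |f x - f y| ≤ E k)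
    (j m : ℕ) (x y : Δ) (hm : 1 ≤ m) (hxy : Y.Agree m x y) :
    |(Y.avg w)^[j] f x - (Y.avg w)^[j] f y| ≤ E (j + m) + C / (1 - θ) * M * θ ^ m := by
  have hfa := adm_of_bounded hw.c_pos hf (Y := Y)
  refine (hw.abs_iterate_sub_le hfa (a := 0) hM0 hE (fun j y _ => ?_) j m x y hm hxy).trans ?_
  · rw [← hw.avg_const M y]
    refine hw.avg_mono ((hw.adm_iterate hfa j).sub (adm_const hw.c_pos 0)).abs
      (adm_const hw.c_pos M) fun α => ?_
    rw [sub_zero]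
    exact hw.abs_iterate_le_of_forall hfa j fun z _ => hf z
  · have h1 := mul_le_mul_of_nonneg_left (hw.sum_pow_le j)
      (mul_nonneg (mul_nonneg hw.C_nonneg hM0) (pow_nonneg hw.θ_pos.le m))
    rw [div_eq_mul_inv]
    linarith

theorem K'_nonneg : 0 ≤ K / (1 - Real.exp (-c)) :=
  div_nonneg hw.K_nonneg (by
    have : Real.exp (-c) < 1 := by rw [Real.exp_lt_one_iff]; linarith [hw.c_pos]
    linarith)

/-- Evolution of a weighted bound under the averaging operator. -/
theorem iterate_weight_le {a b : ℝ} (ha : 0 ≤ a) (hb : 0 ≤ b) (n : ℕ) (x : Δ) :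
    (Y.avg w)^[n] (fun x => a * (1 + b * Real.exp (c * Y.ht x))) x ≤
      a * (1 + b * (Real.exp (-c) ^ n * Real.exp (c * Y.ht x) + K / (1 - Real.exp (-c)))) := by
  rw [iterate_const_mul, hw.iterate_add (adm_const hw.c_pos 1) (adm_exp.const_mul b),
    hw.iterate_const, iterate_const_mul]
  refine mul_le_mul_of_nonneg_left (add_le_add le_rfl ?_) ha
  exact mul_le_mul_of_nonneg_left (hw.iterate_exp_le n x) hb

theorem adm_weight (a b : ℝ) : Y.Adm c (fun x => a * (1 + b * Real.exp (c * Y.ht x))) :=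
  ((adm_const hw.c_pos 1).add (adm_exp.const_mul b)).const_mul a

theorem abs_iterate_sub_const_le {f : Δ → ℝ} (hf : Y.Adm c f) {a b e : ℝ}
    (hfe : ∀ x, |f x - e| ≤ a * (1 + b * Real.exp (c * Y.ht x))) (n : ℕ) (x : Δ) :
    |(Y.avg w)^[n] f x - e| ≤
      (Y.avg w)^[n] (fun x => a * (1 + b * Real.exp (c * Y.ht x))) x := by
  have he := adm_const hw.c_pos e (Y := Y)
  have h1 := hw.abs_iterate_le (hf.sub he) n x
  rw [hw.iterate_sub hf he, hw.iterate_const] at h1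
  exact h1.trans (hw.iterate_mono (hf.sub he).abs (hw.adm_weight a b) hfe n x)

/-- Variations of the iterates for a function with a weighted bound. -/
theorem lip_iterate_of_weight {f : Δ → ℝ} (hf : Y.Adm c f) {a b e ℓ : ℝ} (ha : 0 ≤ a) (hb : 0 ≤ b)
    (hb1 : b ≤ 1) (hfe : ∀ x, |f x - e| ≤ a * (1 + b * Real.exp (c * Y.ht x)))
    (hℓ : Y.Lip θ ℓ f) (n : ℕ) :
    Y.Lip θ (θ ^ n * ℓ + C * (a * (2 + K / (1 - Real.exp (-c)))) / (1 - θ))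
      ((Y.avg w)^[n] f) := by
  intro m x y hm hxy
  have hK := hw.K'_nonneg
  have hM0 : 0 ≤ a * (2 + K / (1 - Real.exp (-c))) := by positivity
  refine (hw.abs_iterate_sub_le hf (a := e) hM0 (E := fun k => ℓ * θ ^ k) (fun k x y hk h => hℓ k x y hk h)
    (fun j y hy => ?_) n m x y hm hxy).trans ?_
  · calc Y.avg w (fun z => |(Y.avg w)^[j] f z - e|) y
        ≤ Y.avg w ((Y.avg w)^[j] (fun x => a * (1 + b * Real.exp (c * Y.ht x)))) y :=
          hw.avg_mono ((hw.adm_iterate hf j).sub (adm_const hw.c_pos e)).abs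
            (hw.adm_iterate (hw.adm_weight a b) j)
            fun α => hw.abs_iterate_sub_const_le hf hfe j _
      _ = (Y.avg w)^[j + 1] (fun x => a * (1 + b * Real.exp (c * Y.ht x))) y := by
          rw [Function.iterate_succ_apply']
      _ ≤ _ := hw.iterate_weight_le ha hb _ _
      _ ≤ _ := by
          refine mul_le_mul_of_nonneg_left ?_ ha
          have hq : Real.exp (-c) ^ (j + 1) ≤ 1 := pow_le_one₀ (Real.exp_pos _).le
            (Real.exp_le_one_iff.2 (by linarith [hw.c_pos]))
          -- Over the basis the Lyapunov weight starts from `1`, so the bound does not depend on the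
          -- point.
          rw [hy, Nat.cast_zero, mul_zero, Real.exp_zero, mul_one]
          have : b * (Real.exp (-c) ^ (j + 1) + K / (1 - Real.exp (-c))) ≤
              1 * (1 + K / (1 - Real.exp (-c))) :=
            mul_le_mul hb1 (by linarith) (by positivity) zero_le_one
          linarith
  · have h1 := mul_le_mul_of_nonneg_left (hw.sum_pow_le n)
      (mul_nonneg (mul_nonneg hw.C_nonneg hM0) (pow_nonneg hw.θ_pos.le m))
    rw [pow_add, add_mul, div_eq_mul_inv _ (1 - θ)]
    linarith

/-- Low points of the tower have a positive proportion of preimages close to each other. -/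
theorem exists_small_set (hap : ∀ k : ℕ, (∀ α, k ∣ Y.φ α) → k = 1) (H n : ℕ) :
    ∃ N ≥ n, ∃ κ, 0 < κ ∧ κ ≤ 1 ∧ ∀ x y, Y.ht x ≤ H → Y.ht y ≤ H → ∃ x' y', Y.Agree n x' y' ∧
      ∀ f, Y.Adm c f → (∀ z, 0 ≤ f z) →
        κ * f x' ≤ (Y.avg w)^[N] f x ∧ κ * f y' ≤ (Y.avg w)^[N] f y := by
  rcases isEmpty_or_nonempty ι with hι | ⟨⟨α₀⟩⟩
  · exact ⟨n, le_rfl, 1, one_pos, le_rfl, fun x => (hι.false (hw.nonempty_index x).some).elim⟩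
  obtain ⟨N₀, hN₀⟩ := exists_return_words hap
  choose κ hκ hκw using hw.lower
  choose! r hr hr0 using hN₀
  -- Descend `h` steps to the basis, return to the basis at an exactly prescribed time, then follow
  -- `n` common branches. The middle length compensates `h`, so the total does not depend on the
  -- starting height; the final common letters make the two endpoints agree for `n` steps.
  let word : ℕ → List ι := fun h =>
    (List.replicate h α₀ ++ r (N₀ + H - h)) ++ List.replicate n α₀
  have hlen : ∀ h ≤ H, (word h).length = N₀ + H + n := fun h hh => by
    simp only [word, List.length_append, List.length_replicate, hr (N₀ + H - h) (by omega)]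
    omega
  have hpos : ∀ h, 0 < ((word h).map κ).prod := fun h =>
    List.prod_pos (by simp only [List.mem_map]; rintro a ⟨γ, _, rfl⟩; exact hκ γ)
  obtain ⟨δ, hδ, hδ1, hδw⟩ : ∃ δ, 0 < δ ∧ δ ≤ 1 ∧ ∀ h ≤ H, δ ≤ ((word h).map κ).prod := by
    obtain ⟨h₀, _, hmin⟩ := (Finset.range (H + 1)).exists_min_image
      (fun h => ((word h).map κ).prod) ⟨0, by simp⟩
    exact ⟨min 1 ((word h₀).map κ).prod, lt_min one_pos (hpos h₀), min_le_left _ _,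
      fun h hh => (min_le_right _ _).trans (hmin h (Finset.mem_range.2 (by omega)))⟩
  have hbase : ∀ x, Y.ht x ≤ H →
      Y.ht (Y.backWord (List.replicate (Y.ht x) α₀ ++ r (N₀ + H - Y.ht x)) x) = 0 := fun x hx => by
    rw [backWord_append]
    exact hr0 _ (by omega) _ (Y.ht_backWord _ List.length_replicate)
  have hmin : ∀ x, Y.ht x ≤ H → ∀ f, Y.Adm c f → (∀ z, 0 ≤ f z) →
      δ * f (Y.backWord (word (Y.ht x)) x) ≤ (Y.avg w)^[N₀ + H + n] f x := fun x hx f hf hf0 => by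
    have := hw.le_iterate_backWord hκ hκw hf hf0 (word (Y.ht x)) x
    rw [hlen _ hx] at this
    exact (mul_le_mul_of_nonneg_right (hδw _ hx) (hf0 _)).trans this
  refine ⟨N₀ + H + n, by omega, δ, hδ, hδ1, fun x y hx hy => ⟨_, _, ?_, fun f hf hf0 =>
    ⟨hmin x hx f hf hf0, hmin y hy f hf hf0⟩⟩⟩
  simp only [word, backWord_append _ (_ ++ _)]
  have := agree_backWord_of_base (hbase x hx) (hbase y hy) (List.replicate n α₀)
  rwa [List.length_replicate] at this

end IsBackwardKernel

end avg

/-! ### Contraction and exponential mixing of the averaging operator -/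

section gap

variable {Y : YoungTower Δ ι} {w : ι → Δ → ℝ} {θ C c K : ℝ}

/-- The function `f` is within `a * (1 + b * exp (c * ht))` of a constant. -/
def NearConst (Y : YoungTower Δ ι) (c b a : ℝ) (f : Δ → ℝ) : Prop :=
  ∃ e, ∀ x, |f x - e| ≤ a * (1 + b * Real.exp (c * Y.ht x))

/-- The infimum of the upper envelope `f + weight` is a suitable constant: the two-point inequality
says that every lower envelope value is below every upper one. -/
theorem nearConst_of_sub_le {f : Δ → ℝ} {a b : ℝ}
    (h : ∀ x y, f y - f x ≤
      a * (1 + b * Real.exp (c * Y.ht x)) + a * (1 + b * Real.exp (c * Y.ht y))) :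
    Y.NearConst c b a f := by
  rcases isEmpty_or_nonempty Δ with hΔ | hΔ
  · exact ⟨0, fun x => (hΔ.false x).elim⟩
  refine ⟨⨅ x, (f x + a * (1 + b * Real.exp (c * Y.ht x))), fun y => abs_le.2 ⟨?_, ?_⟩⟩
  · have : (⨅ x, (f x + a * (1 + b * Real.exp (c * Y.ht x)))) ≤
        f y + a * (1 + b * Real.exp (c * Y.ht y)) :=
      ciInf_le ⟨f y - a * (1 + b * Real.exp (c * Y.ht y)), by
        rintro _ ⟨x, rfl⟩
        linarith [h x y]⟩ y
    linarith
  · have : f y - a * (1 + b * Real.exp (c * Y.ht y)) ≤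
        ⨅ x, (f x + a * (1 + b * Real.exp (c * Y.ht x))) :=
      le_ciInf fun x => by linarith [h x y]
    linarith

namespace IsBackwardKernel

variable (hw : Y.IsBackwardKernel w θ C c K)
include hw

/-- Some iterate of the averaging operator is a contraction. -/
theorem exists_contraction (hap : ∀ k : ℕ, (∀ α, k ∣ Y.φ α) → k = 1) :
    ∃ (N : ℕ) (γ A b : ℝ), 1 ≤ N ∧ 0 < γ ∧ γ < 1 ∧ 0 < A ∧ 0 < b ∧ ∀ f a, 0 ≤ a → Y.Adm c f →
      Y.NearConst c b a f → Y.Lip θ (A * a) f →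
      Y.NearConst c b (γ * a) ((Y.avg w)^[N] f) ∧ Y.Lip θ (A * (γ * a)) ((Y.avg w)^[N] f) := by
  set q := Real.exp (-c) with hq
  have hq0 : 0 < q := Real.exp_pos _
  have hq1 : q < 1 := by rw [hq, Real.exp_lt_one_iff]; linarith [hw.c_pos]
  set K' := K / (1 - q) with hK'
  have hK0 : 0 ≤ K' := hw.K'_nonneg
  have hθ := hw.θ_pos
  have hθ1 : 0 < 1 - θ := by linarith [hw.θ_lt_one]
  have hC := hw.C_nonneg
  set C₂ := C * (2 + K') / (1 - θ) + 1 with hC₂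
  have hC₂0 : 0 < C₂ := by positivity
  -- `C₂ * a` bounds the non-contracting term of the Doeblin–Fortet inequality for a function with
  -- weighted bound `a`; with `A = 4 * C₂` it uses a quarter of the allowance `A * a`, and `θ ^ N ≤
  -- 1 / 4` makes the other term use another quarter.
  set A := 4 * C₂ with hA
  have hA0 : 0 < A := by positivity
  obtain ⟨n₁, hn₁⟩ := exists_pow_lt_of_lt_one (show (0 : ℝ) < 1 / 4 by norm_num) hw.θ_lt_one
  obtain ⟨n₂, hn₂⟩ := exists_pow_lt_of_lt_one (show (0 : ℝ) < 1 / 4 by norm_num) hq1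
  obtain ⟨n₃, hn₃⟩ := exists_pow_lt_of_lt_one (inv_pos.2 hA0) hw.θ_lt_one
  obtain ⟨H, hH⟩ := exists_nat_gt (16 * K' / c)
  set n := n₁ + n₂ + n₃ + 1 with hn
  obtain ⟨N, hN, κ, hκ, hκ1, hsmall⟩ := hw.exists_small_set hap H n
  have hθN : θ ^ N ≤ 1 / 4 := (pow_le_pow_of_le_one hθ.le hw.θ_lt_one.le (by omega)).trans hn₁.le
  have hqN : q ^ N ≤ 1 / 4 := (pow_le_pow_of_le_one hq0.le hq1.le (by omega)).trans hn₂.le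
  have hAθ : A * θ ^ n ≤ 1 := by
    have : θ ^ n ≤ A⁻¹ :=
      (pow_le_pow_of_le_one hθ.le hw.θ_lt_one.le (by omega)).trans hn₃.le
    calc A * θ ^ n ≤ A * A⁻¹ := mul_le_mul_of_nonneg_left this hA0.le
      _ = 1 := mul_inv_cancel₀ hA0.ne'
  -- The weight of the Lyapunov function is so small that its additive drift constant `K'` consumes
  -- at most half of the coupling gain `κ`.
  set b := min 1 (κ / (4 * K' + 4)) with hb
  have hb0 : 0 < b := lt_min one_pos (by positivity)
  have hb1 : b ≤ 1 := min_le_left _ _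
  have hbκ : b * (4 * K' + 4) ≤ κ := by
    rw [← le_div_iff₀ (by positivity)]
    exact min_le_right _ _
  set η := min (1 / 8) (min (b / 2) (κ / 4)) with hη
  have hη0 : 0 < η := lt_min (by norm_num) (lt_min (by positivity) (by positivity))
  have hη1 : η ≤ 1 / 8 := min_le_left _ _
  have hη2 : η ≤ b / 2 := (min_le_right _ _).trans (min_le_left _ _)
  have hη3 : η ≤ κ / 4 := (min_le_right _ _).trans (min_le_right _ _)
  refine ⟨N, 1 - η, A, b, by omega, by linarith, by linarith, hA0, hb0,
    fun f a ha hf hfc hfl => ?_⟩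
  obtain ⟨e, he⟩ := hfc
  constructor
  · refine nearConst_of_sub_le fun x y => ?_
    set Vx := Real.exp (c * Y.ht x) with hVx
    set Vy := Real.exp (c * Y.ht y) with hVy
    have hVx1 : 1 ≤ Vx := one_le_exp_ht hw.c_pos x
    have hVy1 : 1 ≤ Vy := one_le_exp_ht hw.c_pos y
    set Wx := (Y.avg w)^[N] (fun x => a * (1 + b * Real.exp (c * Y.ht x))) x with hWx
    set Wy := (Y.avg w)^[N] (fun x => a * (1 + b * Real.exp (c * Y.ht x))) y with hWy
    have hWx' : Wx ≤ a * (1 + b * (q ^ N * Vx + K')) := hw.iterate_weight_le ha hb0.le N x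
    have hWy' : Wy ≤ a * (1 + b * (q ^ N * Vy + K')) := hw.iterate_weight_le ha hb0.le N y
    have hqx : q ^ N * Vx ≤ 1 / 4 * Vx := mul_le_mul_of_nonneg_right hqN (by linarith)
    have hqy : q ^ N * Vy ≤ 1 / 4 * Vy := mul_le_mul_of_nonneg_right hqN (by linarith)
    have hsum : Wx + Wy ≤ a * (2 + b * ((Vx + Vy) / 4 + 2 * K')) := by
      refine (add_le_add hWx' hWy').trans ?_
      rw [← mul_add]
      refine mul_le_mul_of_nonneg_left ?_ ha
      have := mul_le_mul_of_nonneg_left (add_le_add hqx hqy) hb0.le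
      linarith
    have hηbS : η * (b * (Vx + Vy)) ≤ 1 / 8 * (b * (Vx + Vy)) :=
      mul_le_mul_of_nonneg_right hη1 (mul_nonneg hb0.le (by linarith))
    have hgoal : (1 - η) * a * (1 + b * Vx) + (1 - η) * a * (1 + b * Vy) =
        a * ((1 - η) * (2 + b * (Vx + Vy))) := by ring
    rw [hgoal]
    -- If one of the two points is high, the drift alone contracts the weighted bound. Otherwise
    -- both heights are at most `H` and the coupling of preimages provides the gain.
    by_cases hS : 16 * K' ≤ Vx + Vy
    · have h1 := abs_le.1 (hw.abs_iterate_sub_const_le hf he N x)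
      have h2 := abs_le.1 (hw.abs_iterate_sub_const_le hf he N y)
      refine le_trans (show _ ≤ Wx + Wy by linarith [h1.1, h2.2]) (hsum.trans ?_)
      refine mul_le_mul_of_nonneg_left ?_ ha
      have h3 := mul_le_mul_of_nonneg_left hS hb0.le
      have h4 := mul_le_mul_of_nonneg_left (add_le_add hVx1 hVy1) hb0.le
      linarith
    · have hht : ∀ z, Real.exp (c * Y.ht z) ≤ 16 * K' → Y.ht z ≤ H := fun z hz => by
        have h1 := Real.add_one_le_exp (c * Y.ht z)
        rw [div_lt_iff₀ hw.c_pos] at hH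
        have h2 : (Y.ht z : ℝ) * c < H * c := by linarith
        exact_mod_cast (lt_of_mul_lt_mul_right h2 hw.c_pos.le).le
      obtain ⟨x', y', hxy', hmin⟩ := hsmall x y (hht x (by linarith)) (hht y (by linarith))
      have he' := adm_const hw.c_pos e (Y := Y)
      have hWa := hw.adm_weight a b
      -- The functions `weight + (f - e)` and `weight - (f - e)` are nonnegative. Minorizing the
      -- first from `x` and the second from `y` by their values at the nearby points `x'` and `y'`
      -- gains `κ` times a sum that is at least `2 * a - (f y' - f x') ≥ a`.
      have hp := (hmin _ (hWa.add (hf.sub he')) (fun z => by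
        have := (abs_le.1 (he z)).1; linarith)).1
      have hm := (hmin _ (hWa.sub (hf.sub he')) (fun z => by
        have := (abs_le.1 (he z)).2; linarith)).2
      rw [hw.iterate_add hWa (hf.sub he'), hw.iterate_sub hf he', hw.iterate_const] at hp
      rw [hw.iterate_sub hWa (hf.sub he'), hw.iterate_sub hf he', hw.iterate_const] at hm
      have hl := (abs_le.1 (hfl n x' y' (by omega) hxy')).1
      have hl' : A * a * θ ^ n ≤ a := by
        calc A * a * θ ^ n = (A * θ ^ n) * a := by ring
          _ ≤ 1 * a := mul_le_mul_of_nonneg_right hAθ ha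
          _ = a := one_mul a
      have hVa : ∀ z, a ≤ a * (1 + b * Real.exp (c * Y.ht z)) := fun z =>
        le_mul_of_one_le_right ha (le_add_of_nonneg_right (by positivity))
      have hκ2 : κ * a ≤ κ * ((a * (1 + b * Real.exp (c * Y.ht x')) + (f x' - e)) +
          (a * (1 + b * Real.exp (c * Y.ht y')) - (f y' - e))) :=
        mul_le_mul_of_nonneg_left (by linarith [hVa x', hVa y']) hκ.le
      have : (Y.avg w)^[N] f y - (Y.avg w)^[N] f x ≤ Wx + Wy - κ * a := by
        rw [mul_add] at hκ2
        linarith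
      refine this.trans ((sub_le_sub_right hsum _).trans ?_)
      rw [mul_comm κ a, ← mul_sub]
      refine mul_le_mul_of_nonneg_left ?_ ha
      have hbV : 0 ≤ b * (Vx + Vy) := mul_nonneg hb0.le (by linarith)
      linarith
  · intro m x y hm hxy
    refine (hw.lip_iterate_of_weight hf ha hb0.le hb1 he hfl N m x y hm hxy).trans ?_
    refine mul_le_mul_of_nonneg_right ?_ (pow_nonneg hθ.le m)
    have h1 : C * (a * (2 + K')) / (1 - θ) ≤ C₂ * a := by
      rw [hC₂, show C * (a * (2 + K')) / (1 - θ) = C * (2 + K') / (1 - θ) * a by ring]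
      exact mul_le_mul_of_nonneg_right (by linarith) ha
    have h2 : θ ^ N * (A * a) ≤ 1 / 4 * (A * a) := mul_le_mul_of_nonneg_right hθN (by positivity)
    have h3 : C₂ * a = 1 / 4 * (A * a) := by rw [hA]; ring
    have h4 : η * (A * a) ≤ 1 / 8 * (A * a) := mul_le_mul_of_nonneg_right hη1 (by positivity)
    have h5 : 0 ≤ A * a := by positivity
    calc _ ≤ 1 / 4 * (A * a) + 1 / 4 * (A * a) := by linarith
      _ ≤ A * a - η * (A * a) := by linarith
      _ = _ := by ring

/-- Exponential mixing of the backward dynamics, seen from the basis. -/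
theorem exists_gap_base (hap : ∀ k : ℕ, (∀ α, k ∣ Y.φ α) → k = 1) :
    ∃ (ρ₀ D : ℝ), 0 < ρ₀ ∧ ρ₀ < 1 ∧ 0 ≤ D ∧ ∀ ρ, ρ₀ ≤ ρ → ρ ≤ 1 → ∀ ψ M, 0 ≤ M →
      (∀ x, |ψ x| ≤ M) → Y.Lip θ M ψ →
      ∃ e, ∀ m x, Y.ht x = 0 → |(Y.avg w)^[m] ψ x - e| ≤ D * M * ρ ^ m := by
  obtain ⟨N, γ, A, b, hN, hγ, hγ1, hA, hb, hcontr⟩ := hw.exists_contraction hap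
  have hK := hw.K'_nonneg
  set K' := K / (1 - Real.exp (-c)) with hK'
  have hγ2 : 0 < 1 - γ := by linarith
  set D₁ := (1 + A⁻¹) * (1 + b * (1 + K')) with hD₁
  have hD₁0 : 0 ≤ D₁ := by positivity
  -- A factor `γ` is gained every `N` steps, hence the rate `γ ^ (1 / N)`. Slower rates `ρ` are
  -- allowed as well, so that `ρ` can later be adjusted to the tail exponent `c`.
  refine ⟨γ ^ ((N : ℝ)⁻¹), (D₁ + 2 * D₁ / (1 - γ)) / γ, Real.rpow_pos_of_pos hγ _,
    Real.rpow_lt_one hγ.le hγ1 (by positivity), by positivity, fun ρ hρ hρ1 ψ M hM hψ hψl => ?_⟩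
  have hρ0 : 0 < ρ := (Real.rpow_pos_of_pos hγ _).trans_le hρ
  have hρN : γ ≤ ρ ^ N := by
    calc γ = (γ ^ ((N : ℝ)⁻¹)) ^ N := (Real.rpow_inv_natCast_pow hγ.le (by omega)).symm
      _ ≤ ρ ^ N := pow_le_pow_left₀ (Real.rpow_pos_of_pos hγ _).le hρ N
  have hψa := adm_of_bounded hw.c_pos hψ (Y := Y)
  -- This choice gives both `M ≤ a` and `M ≤ A * a`, as the two initial bounds require.
  set a := M * (1 + A⁻¹) with ha
  have ha0 : 0 ≤ a := by positivity
  have hiter : ∀ k, Y.NearConst c b (γ ^ k * a) ((Y.avg w)^[N * k] ψ) ∧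
      Y.Lip θ (A * (γ ^ k * a)) ((Y.avg w)^[N * k] ψ) := by
    intro k
    induction k with
    | zero =>
      refine ⟨⟨0, fun x => ?_⟩, fun m x y hm hxy => (hψl m x y hm hxy).trans ?_⟩
      · simp only [pow_zero, one_mul, mul_zero, Function.iterate_zero, id, sub_zero]
        refine (hψ x).trans ?_
        have h1 : M ≤ a := le_mul_of_one_le_right hM (by linarith [inv_pos.2 hA])
        exact h1.trans (le_mul_of_one_le_right ha0 (le_add_of_nonneg_right (by positivity)))
      · refine mul_le_mul_of_nonneg_right ?_ (pow_nonneg hw.θ_pos.le m)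
        rw [pow_zero, one_mul, ha]
        have : A * (M * (1 + A⁻¹)) = A * M + M := by field_simp
        rw [this]
        exact le_add_of_nonneg_left (by positivity)
    | succ k ih =>
      have h := hcontr _ _ (by positivity) (hw.adm_iterate hψa (N * k)) ih.1 ih.2
      rw [show N * (k + 1) = N + N * k by ring, Function.iterate_add_apply,
        show γ ^ (k + 1) * a = γ * (γ ^ k * a) by ring]
      exact h
  choose e he using fun k => (hiter k).1
  have hbase : ∀ k n x, Y.ht x = 0 → |(Y.avg w)^[n + N * k] ψ x - e k| ≤ γ ^ k * (M * D₁) := by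
    intro k n x hx
    rw [Function.iterate_add_apply]
    refine (hw.abs_iterate_sub_const_le (hw.adm_iterate hψa (N * k)) (he k) n x).trans
      ((hw.iterate_weight_le (by positivity) hb.le n x).trans ?_)
    have hq : Real.exp (-c) ^ n ≤ 1 := pow_le_one₀ (Real.exp_pos _).le
      (Real.exp_le_one_iff.2 (by linarith [hw.c_pos]))
    rw [hx, Nat.cast_zero, mul_zero, Real.exp_zero, mul_one, ha, hD₁, ← mul_assoc M, mul_assoc]
    refine mul_le_mul_of_nonneg_left (mul_le_mul_of_nonneg_left ?_ ha0) (pow_nonneg hγ.le k)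
    have := mul_le_mul_of_nonneg_left (add_le_add hq (le_refl K')) hb.le
    linarith
  by_cases hne : ∃ x, Y.ht x = 0
  swap
  · exact ⟨0, fun m x hx => (hne ⟨x, hx⟩).elim⟩
  obtain ⟨x₀, hx₀⟩ := hne
  -- Both `e k` and `e (k + 1)` approximate the same number, the iterate of order `N * (k + 1)` at
  -- `x₀`.
  have hstep : ∀ k, dist (e k) (e (k + 1)) ≤ 2 * (M * D₁) * γ ^ k := by
    intro k
    have h1 := abs_le.1 (hbase k N x₀ hx₀)
    have h2 := abs_le.1 (hbase (k + 1) 0 x₀ hx₀)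
    rw [show 0 + N * (k + 1) = N + N * k by ring] at h2
    have h3 : γ ^ (k + 1) * (M * D₁) ≤ γ ^ k * (M * D₁) := mul_le_mul_of_nonneg_right
      (pow_le_pow_of_le_one hγ.le hγ1.le (Nat.le_succ k)) (by positivity)
    rw [Real.dist_eq, abs_le]
    constructor <;> linarith [h1.1, h1.2, h2.1, h2.2]
  obtain ⟨e', he'⟩ := cauchySeq_tendsto_of_complete (cauchySeq_of_le_geometric _ _ hγ1 hstep)
  refine ⟨e', fun m x hx => ?_⟩
  have h1 := hbase (m / N) (m % N) x hx
  rw [Nat.mod_add_div] at h1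
  have h2 := dist_le_of_le_geometric_of_tendsto _ _ hγ1 hstep he' (m / N)
  rw [Real.dist_eq] at h2
  have h3 : γ ^ (m / N) ≤ ρ ^ m / γ := by
    rw [le_div_iff₀ hγ]
    calc γ ^ (m / N) * γ ≤ (ρ ^ N) ^ (m / N) * ρ ^ (m % N) := by
          refine mul_le_mul (pow_le_pow_left₀ hγ.le hρN _) (hρN.trans ?_) hγ.le (by positivity)
          exact pow_le_pow_of_le_one hρ0.le hρ1 (Nat.mod_lt _ (by omega)).le
      _ = ρ ^ m := by rw [← pow_mul, ← pow_add, Nat.div_add_mod]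
  calc |(Y.avg w)^[m] ψ x - e'| ≤ |(Y.avg w)^[m] ψ x - e (m / N)| + |e (m / N) - e'| :=
        abs_sub_le _ _ _
    _ ≤ γ ^ (m / N) * ((D₁ + 2 * D₁ / (1 - γ)) * M) := by
        refine (add_le_add h1 h2).trans (le_of_eq ?_)
        ring
    _ ≤ ρ ^ m / γ * ((D₁ + 2 * D₁ / (1 - γ)) * M) := mul_le_mul_of_nonneg_right h3 (by positivity)
    _ = _ := by ring

/-- Exponential mixing of the backward dynamics. -/
theorem exists_gap (hap : ∀ k : ℕ, (∀ α, k ∣ Y.φ α) → k = 1) :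
    ∃ (ρ₀ D : ℝ), 0 < ρ₀ ∧ ρ₀ < 1 ∧ 0 < D ∧ ∀ ρ, ρ₀ ≤ ρ → ρ ≤ 1 → ∀ ψ M, 0 ≤ M →
      (∀ x, |ψ x| ≤ M) → Y.Lip θ M ψ →
      ∃ e, ∀ m x, |(Y.avg w)^[m] ψ x - e| ≤ D * M * ρ ^ (m - Y.ht x) := by
  obtain ⟨ρ₀, D, hρ₀, hρ₀1, hD, hgap⟩ := hw.exists_gap_base hap
  refine ⟨ρ₀, D + 2, hρ₀, hρ₀1, by positivity, fun ρ hρ hρ1 ψ M hM hψ hψl => ?_⟩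
  obtain ⟨e, he⟩ := hgap ρ hρ hρ1 ψ M hM hψ hψl
  have hρ0 : 0 ≤ ρ := hρ₀.le.trans hρ
  refine ⟨e, fun m x => ?_⟩
  -- The first `ht x` backward steps are deterministic and lead to the basis. When `m < ht x` the
  -- truncated exponent is `0` and the sup bound suffices; this is the reason for `D + 2`.
  obtain ⟨y, hy, hyu⟩ := hw.exists_base_point x
  rcases le_or_gt (Y.ht x) m with hm | hm
  · obtain ⟨k, rfl⟩ := Nat.exists_eq_add_of_le' hm
    rw [hyu, Nat.add_sub_cancel]
    refine (he k y hy).trans ?_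
    exact mul_le_mul_of_nonneg_right (mul_le_mul_of_nonneg_right (by linarith) hM)
      (pow_nonneg hρ0 k)
  · rw [Nat.sub_eq_zero_of_le hm.le, pow_zero, mul_one]
    have h1 := abs_le.1 (hw.abs_iterate_le_of_forall (adm_of_bounded hw.c_pos hψ) m (x := x)
      fun z _ => hψ z)
    have h2 := abs_le.1 (hψ y)
    have h3 := abs_le.1 (he 0 y hy)
    rw [Function.iterate_zero, id, pow_zero, mul_one] at h3
    rw [abs_le]
    constructor <;> linarith [h1.1, h1.2, h2.1, h2.2, h3.1, h3.2]

end IsBackwardKernel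

end gap

/-! ### Convolution with a geometric sequence -/

section conv

/-- Convolution of `L` with the geometric sequence of ratio `θ`, towards the future. -/
noncomputable def expConv (θ : ℝ) (L : ℕ → ℝ) (p : ℕ) : ℝ :=
  ∑ q ∈ Finset.range (p + 1), L q * θ ^ (p - q)

/-- Convolution of `L` with the geometric sequence of ratio `θ`, towards the past. -/
noncomputable def expConvBack (θ : ℝ) (M : ℕ) (L : ℕ → ℝ) (p : ℕ) : ℝ :=
  ∑ q ∈ Finset.Ico p M, L q * θ ^ (q - p)

variable {θ : ℝ} {L : ℕ → ℝ}

theorem expConv_zero : expConv θ L 0 = L 0 := by simp [expConv]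

theorem expConv_succ (p : ℕ) : expConv θ L (p + 1) = L (p + 1) + θ * expConv θ L p := by
  rw [expConv, Finset.sum_range_succ, Nat.sub_self, pow_zero, mul_one, add_comm, expConv,
    Finset.mul_sum]
  congr 1
  refine Finset.sum_congr rfl fun q hq => ?_
  rw [Nat.succ_sub (Nat.lt_succ_iff.1 (Finset.mem_range.1 hq)), pow_succ]
  ring

theorem expConvBack_of_le {M p : ℕ} (h : M ≤ p) : expConvBack θ M L p = 0 := by
  rw [expConvBack, Finset.Ico_eq_empty_of_le h, Finset.sum_empty]

theorem expConvBack_of_lt {M p : ℕ} (h : p < M) :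
    expConvBack θ M L p = L p + θ * expConvBack θ M L (p + 1) := by
  rw [expConvBack, Finset.sum_eq_sum_Ico_succ_bot h, Nat.sub_self, pow_zero, mul_one, expConvBack,
    Finset.mul_sum]
  congr 1
  refine Finset.sum_congr rfl fun q hq => ?_
  rw [show q - p = q - (p + 1) + 1 by have := (Finset.mem_Ico.1 hq).1; omega, pow_succ]
  ring

theorem expConv_nonneg (hθ : 0 ≤ θ) (hL : ∀ q, 0 ≤ L q) (p : ℕ) : 0 ≤ expConv θ L p :=
  Finset.sum_nonneg fun q _ => mul_nonneg (hL q) (pow_nonneg hθ _)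

theorem expConvBack_nonneg (hθ : 0 ≤ θ) (hL : ∀ q, 0 ≤ L q) (M p : ℕ) :
    0 ≤ expConvBack θ M L p :=
  Finset.sum_nonneg fun q _ => mul_nonneg (hL q) (pow_nonneg hθ _)

theorem le_expConv (hθ : 0 ≤ θ) (hL : ∀ q, 0 ≤ L q) (p : ℕ) : L p ≤ expConv θ L p := by
  have := Finset.single_le_sum (f := fun q => L q * θ ^ (p - q))
    (fun q _ => mul_nonneg (hL q) (pow_nonneg hθ _)) (Finset.self_mem_range_succ p)
  rw [expConv]
  simpa using this

theorem expConv_le (hθ : 0 ≤ θ) (hθ1 : θ < 1) {ε : ℝ} (hε : 0 ≤ ε) (hL : ∀ q, L q ≤ ε) (p : ℕ) :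
    expConv θ L p ≤ ε / (1 - θ) := by
  have h1 : 0 < 1 - θ := by linarith
  have key : ε / (1 - θ) = ε + θ * (ε / (1 - θ)) := by field_simp; ring
  induction p with
  | zero =>
    rw [expConv_zero]
    exact (hL 0).trans (by rw [key]; exact le_add_of_nonneg_right (by positivity))
  | succ p ih =>
    rw [expConv_succ, key]
    exact add_le_add (hL _) (mul_le_mul_of_nonneg_left ih hθ)

theorem expConvBack_le (hθ : 0 ≤ θ) (hθ1 : θ < 1) {ε : ℝ} (hε : 0 ≤ ε) (hL : ∀ q, L q ≤ ε)
    (M p : ℕ) : expConvBack θ M L p ≤ ε / (1 - θ) := by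
  have h1 : 0 < 1 - θ := by linarith
  have key : ε / (1 - θ) = ε + θ * (ε / (1 - θ)) := by field_simp; ring
  rcases le_or_gt M p with hp | hp
  · rw [expConvBack_of_le hp]; positivity
  · induction hp.le using Nat.decreasingInduction with
    | self => exact absurd hp (lt_irrefl _)
    | of_succ k hk ih =>
      rw [expConvBack_of_lt hk, key]
      refine add_le_add (hL _) (mul_le_mul_of_nonneg_left ?_ hθ)
      rcases Nat.eq_or_lt_of_le (Nat.succ_le_of_lt hk) with h | h
      · rw [← h, expConvBack_of_le le_rfl]; positivity
      · exact ih h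

/-- Convexity of the square, for the combination of `a / (1 - θ)` and `b` with weights `1 - θ` and
`θ`. It turns the recursions for the convolutions into the `ℓ²` case of Young's inequality, with
constant `(1 - θ)⁻¹`. -/
theorem sq_add_mul_le (hθ : 0 ≤ θ) (hθ1 : θ < 1) (a b : ℝ) :
    (a + θ * b) ^ 2 ≤ a ^ 2 / (1 - θ) + θ * b ^ 2 := by
  have h1 : 0 < 1 - θ := by linarith
  have : a ^ 2 / (1 - θ) + θ * b ^ 2 - (a + θ * b) ^ 2 = θ / (1 - θ) * (a - (1 - θ) * b) ^ 2 := by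
    field_simp
    ring
  have h2 : 0 ≤ θ / (1 - θ) * (a - (1 - θ) * b) ^ 2 := by positivity
  linarith

theorem sum_expConv_sq_le (hθ : 0 ≤ θ) (hθ1 : θ < 1) (P : ℕ) :
    ∑ p ∈ Finset.range P, expConv θ L p ^ 2 ≤
      (1 - θ)⁻¹ ^ 2 * ∑ q ∈ Finset.range P, L q ^ 2 := by
  have h1 : 0 < 1 - θ := by linarith
  have key : ∀ P, ∑ p ∈ Finset.range P, expConv θ L p ^ 2 ≤
      (∑ q ∈ Finset.range P, L q ^ 2) / (1 - θ) +
        θ * ∑ p ∈ Finset.range (P - 1), expConv θ L p ^ 2 := by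
    intro P
    cases P with
    | zero => simp
    | succ P =>
      rw [Nat.add_sub_cancel]
      induction P with
      | zero =>
        simp only [zero_add, Finset.range_one, Finset.sum_singleton, expConv_zero,
          Finset.range_zero, Finset.sum_empty, mul_zero, add_zero]
        rw [le_div_iff₀ h1]
        nlinarith [sq_nonneg (L 0)]
      | succ P ih =>
        rw [Finset.sum_range_succ _ (P + 1), Finset.sum_range_succ (fun q => L q ^ 2) (P + 1),
          add_div, expConv_succ]
        rw [Finset.sum_range_succ (fun p => expConv θ L p ^ 2) P] at ih ⊢
        linarith [sq_add_mul_le hθ hθ1 (L (P + 1)) (expConv θ L P)]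
  have h2 : ∑ p ∈ Finset.range (P - 1), expConv θ L p ^ 2 ≤
      ∑ p ∈ Finset.range P, expConv θ L p ^ 2 :=
    Finset.sum_le_sum_of_subset_of_nonneg (Finset.range_mono (Nat.sub_le _ _))
      fun _ _ _ => sq_nonneg _
  have h3 := (key P).trans (add_le_add le_rfl (mul_le_mul_of_nonneg_left h2 hθ))
  have h4 : (∑ p ∈ Finset.range P, expConv θ L p ^ 2) * (1 - θ) ≤
      (∑ q ∈ Finset.range P, L q ^ 2) / (1 - θ) := by linarith
  rw [← le_div_iff₀ h1] at h4
  refine h4.trans (le_of_eq ?_)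
  field_simp

theorem sum_expConvBack_sq_le (hθ : 0 ≤ θ) (hθ1 : θ < 1) {M P : ℕ} (hMP : M ≤ P) :
    ∑ p ∈ Finset.range P, expConvBack θ M L p ^ 2 ≤
      (1 - θ)⁻¹ ^ 2 * ∑ q ∈ Finset.range P, L q ^ 2 := by
  have h1 : 0 < 1 - θ := by linarith
  have h0 : ∑ p ∈ Finset.range P, expConvBack θ M L (p + 1) ^ 2 ≤
      ∑ p ∈ Finset.range P, expConvBack θ M L p ^ 2 := by
    have := Finset.sum_range_succ' (fun p => expConvBack θ M L p ^ 2) P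
    rw [Finset.sum_range_succ, expConvBack_of_le hMP] at this
    nlinarith [sq_nonneg (expConvBack θ M L 0)]
  have h2 : ∑ p ∈ Finset.range P, expConvBack θ M L p ^ 2 ≤
      ∑ p ∈ Finset.range P, (L p ^ 2 / (1 - θ) + θ * expConvBack θ M L (p + 1) ^ 2) := by
    refine Finset.sum_le_sum fun p _ => ?_
    rcases le_or_gt M p with hp | hp
    · rw [expConvBack_of_le hp, zero_pow two_ne_zero]; positivity
    · rw [expConvBack_of_lt hp]
      exact sq_add_mul_le hθ hθ1 _ _
  rw [Finset.sum_add_distrib, ← Finset.mul_sum, ← Finset.sum_div] at h2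
  have h3 := h2.trans (add_le_add le_rfl (mul_le_mul_of_nonneg_left h0 hθ))
  have h4 : (∑ p ∈ Finset.range P, expConvBack θ M L p ^ 2) * (1 - θ) ≤
      (∑ q ∈ Finset.range P, L q ^ 2) / (1 - θ) := by linarith
  rw [← le_div_iff₀ h1] at h4
  refine h4.trans (le_of_eq ?_)
  field_simp

/-- At most `h` terms are spoiled by the truncation, each by at most `1`; the others form a
geometric series. The growth is thus linear in `h`. -/
theorem sum_pow_sub_le {ρ : ℝ} (hρ : 0 ≤ ρ) (hρ1 : ρ < 1) (p h : ℕ) :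
    ∑ q ∈ Finset.range p, ρ ^ ((p - q) - h) ≤ h + (1 - ρ)⁻¹ := by
  have key : ∀ n, ∑ j ∈ Finset.range n, ρ ^ (j - h) ≤ h + (1 - ρ)⁻¹ := by
    induction h with
    | zero =>
      intro n
      rw [← tsum_geometric_of_lt_one hρ hρ1, Nat.cast_zero, zero_add]
      exact (summable_geometric_of_lt_one hρ hρ1).sum_le_tsum _ fun i _ => pow_nonneg hρ i
    | succ h ih =>
      intro n
      cases n with
      | zero =>
        have : 0 < 1 - ρ := by linarith
        rw [Finset.range_zero, Finset.sum_empty]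
        positivity
      | succ n =>
        rw [Finset.sum_range_succ', Nat.zero_sub, pow_zero]
        simp only [Nat.add_sub_add_right]
        push_cast
        linarith [ih n]
  refine le_trans ?_ (key (p + 1))
  rw [Finset.sum_range_succ', ← Finset.sum_range_reflect]
  refine le_trans (le_of_eq (Finset.sum_congr rfl fun j hj => ?_))
    (le_add_of_nonneg_right (pow_nonneg hρ _))
  have := Finset.mem_range.1 hj
  congr 2
  omega

end conv

/-! ### Separately Lipschitz functions along orbits -/

/-- The orbits of `x` and `y` visit the same elements of the partition at all times at distance
less than `r` from `j`. -/
def AgreeAround (Y : YoungTower Δ ι) (j r : ℕ) (x y : Δ) : Prop :=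
  ∀ k, k < j + r → j < k + r → Y.SameCell (Y.T^[k] x) (Y.T^[k] y)

/-- The function `J` depends on its coordinates of index `< M`, and its dependence on the `j`-th
coordinate `z` is Lipschitz, with constant `L j`, for the distance `θ ^ r` where `r` is the size
of the largest window around `T^j z` on which the orbits agree. -/
structure IsOrbitLipschitz (Y : YoungTower Δ ι) (θ : ℝ) (M : ℕ) (L : ℕ → ℝ) (J : (ℕ → Δ) → ℝ) :
    Prop where
  nonneg : ∀ j, 0 ≤ L j
  eq_zero : ∀ j, M ≤ j → L j = 0
  congr : ∀ x y : ℕ → Δ, (∀ j < M, x j = y j) → J x = J y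
  abs_sub_le : ∀ j r (x : ℕ → Δ) z, Y.AgreeAround j r (x j) z →
    |J x - J (Function.update x j z)| ≤ L j * θ ^ r

namespace IsOrbitLipschitz

variable {Y : YoungTower Δ ι} {θ : ℝ} {M : ℕ} {L : ℕ → ℝ} {J : (ℕ → Δ) → ℝ}
  (hJ : Y.IsOrbitLipschitz θ M L J)
include hJ

/-- The coordinates of `x` are replaced one at a time by those of `y`. -/
theorem abs_sub_le_sum {a : ℕ → ℝ} (x y : ℕ → Δ)
    (h : ∀ j < M, ∀ u : ℕ → Δ, u j = x j → |J u - J (Function.update u j (y j))| ≤ a j) :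
    |J x - J y| ≤ ∑ j ∈ Finset.range M, a j := by
  have key : ∀ n ≤ M, |J x - J (fun j => if j < n then y j else x j)| ≤
      ∑ j ∈ Finset.range n, a j := by
    intro n hn
    induction n with
    | zero => simp
    | succ n ih =>
      rw [Finset.sum_range_succ]
      have h1 := h n (by omega) (fun j => if j < n then y j else x j) (by simp)
      have h2 : Function.update (fun j => if j < n then y j else x j) n (y n) =
          fun j => if j < n + 1 then y j else x j := by
        funext j
        rcases eq_or_ne j n with rfl | hj
        · simp
        · rw [Function.update_of_ne hj]
          by_cases h3 : j < n
          · simp [h3, Nat.lt_succ_of_lt h3]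
          · have : ¬ j < n + 1 := by omega
            simp [h3, this]
      rw [h2] at h1
      exact (_root_.abs_sub_le _ _ _).trans (add_le_add (ih (by omega)) h1)
  have h1 := key M le_rfl
  rwa [hJ.congr (fun j => if j < M then y j else x j) y (fun j hj => by simp [hj])] at h1

theorem abs_sub_le_const (x y : ℕ → Δ) : |J x - J y| ≤ ∑ j ∈ Finset.range M, L j :=
  hJ.abs_sub_le_sum x y fun j _ u _ => by
    simpa using hJ.abs_sub_le j 0 u (y j) fun k h1 h2 => absurd h1 (by omega)

/-- The variations of the diagonal function. -/
theorem abs_diag_sub_le {k : ℕ} {z z' : Δ} (h : Y.Agree k z z') :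
    |J (fun _ => z) - J (fun _ => z')| ≤ ∑ j ∈ Finset.range M, L j * θ ^ (k - j) :=
  hJ.abs_sub_le_sum _ _ fun j _ u hu => hJ.abs_sub_le j (k - j) u z' (by
    rw [hu]
    exact fun i h1 h2 => h i (by omega))

/-- The constant is crude and grows exponentially with `M`. It serves only qualitatively, for
measurability and for the convergence of the iterates, and does not enter the final estimate. -/
theorem lip_diag (hθ : 0 < θ) (hθ1 : θ < 1) :
    Y.Lip θ (∑ j ∈ Finset.range M, L j * θ⁻¹ ^ j) (fun z => J (fun _ => z)) := by
  intro m x y _ hxy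
  refine (hJ.abs_diag_sub_le hxy).trans ?_
  rw [Finset.sum_mul]
  refine Finset.sum_le_sum fun j _ => ?_
  rw [mul_assoc]
  refine mul_le_mul_of_nonneg_left ?_ (hJ.nonneg j)
  rw [inv_pow, ← div_eq_inv_mul, le_div_iff₀ (pow_pos hθ j), ← pow_add]
  exact pow_le_pow_of_le_one hθ.le hθ1.le (by omega)

end IsOrbitLipschitz

/-- The function `J`, where the first `q` coordinates are equal to `z` and the other ones
to `w`. -/
def splice (J : (ℕ → Δ) → ℝ) (w : Δ) (q : ℕ) (z : Δ) : ℝ := J fun j => if j < q then z else w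

namespace IsOrbitLipschitz

variable {Y : YoungTower Δ ι} {θ : ℝ} {M : ℕ} {L : ℕ → ℝ} {J : (ℕ → Δ) → ℝ}
  (hJ : Y.IsOrbitLipschitz θ M L J)
include hJ

theorem abs_splice_succ_sub_le {w z : Δ} {q r : ℕ} (h : Y.AgreeAround q r z w) :
    |splice J w (q + 1) z - splice J w q z| ≤ L q * θ ^ r := by
  have h1 := hJ.abs_sub_le q r (fun j => if j < q + 1 then z else w) w (by simpa using h)
  have h2 : Function.update (fun j => if j < q + 1 then z else w) q w =
      fun j => if j < q then z else w := by
    funext j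
    rcases eq_or_ne j q with rfl | hj
    · simp
    · rw [Function.update_of_ne hj]
      by_cases h3 : j < q
      · simp [h3, Nat.lt_succ_of_lt h3]
      · have : ¬ j < q + 1 := by omega
        simp [h3, this]
  rwa [h2] at h1

theorem abs_splice_succ_sub_le_const (w z : Δ) (q : ℕ) :
    |splice J w (q + 1) z - splice J w q z| ≤ L q := by
  simpa using hJ.abs_splice_succ_sub_le (r := 0) (w := w) (z := z) (q := q)
    fun k h1 h2 => absurd h1 (by omega)

theorem abs_splice_sub_le (hθ : 0 ≤ θ) (w : Δ) (q : ℕ) {k : ℕ} {z z' : Δ} (h : Y.Agree k z z') :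
    |splice J w q z - splice J w q z'| ≤ ∑ j ∈ Finset.range q, L j * θ ^ (k - j) := by
  refine (hJ.abs_sub_le_sum (a := fun j => if j < q then L j * θ ^ (k - j) else 0) _ _
    fun j _ u hu => ?_).trans ?_
  · by_cases hj : j < q
    · simp only [hj, if_true] at hu ⊢
      exact hJ.abs_sub_le j (k - j) u z' (by rw [hu]; exact fun i h1 h2 => h i (by omega))
    · simp only [hj, if_false] at hu ⊢
      rw [← hu, Function.update_eq_self, sub_self, abs_zero]
  · rw [← Finset.sum_filter]
    refine Finset.sum_le_sum_of_subset_of_nonneg (fun j hj => ?_)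
      fun j _ _ => mul_nonneg (hJ.nonneg j) (pow_nonneg hθ _)
    exact Finset.mem_range.2 (Finset.mem_filter.1 hj).2

omit hJ in
theorem splice_zero (w z : Δ) : splice J w 0 z = J fun _ => w := by simp [splice]

theorem diag_eq_splice (w : Δ) {n : ℕ} (hn : M ≤ n) (z : Δ) :
    J (fun _ => z) = splice J w n z :=
  hJ.congr _ _ fun j hj => by rw [if_pos (hj.trans_le hn)]

variable {w : ι → Δ → ℝ} {C c K : ℝ} (hw : Y.IsBackwardKernel w θ C c K)
include hw

/-- Averaging `q` times gives the preimages `q` additional steps of agreement, which turns the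
variations of the `q`-th increment into a constant comparable to `L q`, up to convolution, instead
of the crude constant of `lip_diag`. -/
theorem abs_increment_iterate_sub_le (w₀ : Δ) (q : ℕ) :
    Y.Lip θ ((2 + C / (1 - θ)) * expConv θ L q)
      ((Y.avg w)^[q] (fun z => splice J w₀ (q + 1) z - splice J w₀ q z)) := by
  intro m x y hm hxy
  have hθ := hw.θ_pos
  have hθ1 := hw.θ_lt_one
  have h1θ : 0 < 1 - θ := by linarith
  refine (hw.abs_iterate_sub_le_of_bounded (hJ.nonneg q)
    (fun z => hJ.abs_splice_succ_sub_le_const w₀ z q)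
    (E := fun k => 2 * ∑ j ∈ Finset.range (q + 1), L j * θ ^ (k - j))
    (fun k x y _ h => ?_) q m x y hm hxy).trans ?_
  · have h1 := hJ.abs_splice_sub_le hθ.le w₀ (q + 1) h
    have h2 := hJ.abs_splice_sub_le hθ.le w₀ q h
    have h3 : ∑ j ∈ Finset.range q, L j * θ ^ (k - j) ≤
        ∑ j ∈ Finset.range (q + 1), L j * θ ^ (k - j) := by
      rw [Finset.sum_range_succ]
      exact le_add_of_nonneg_right (mul_nonneg (hJ.nonneg q) (pow_nonneg hθ.le _))
    rw [abs_le] at h1 h2 ⊢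
    constructor <;> linarith [h1.1, h1.2, h2.1, h2.2]
  · have h1 : ∑ j ∈ Finset.range (q + 1), L j * θ ^ (q + m - j) = expConv θ L q * θ ^ m := by
      rw [expConv, Finset.sum_mul]
      refine Finset.sum_congr rfl fun j hj => ?_
      have := Finset.mem_range.1 hj
      rw [mul_assoc, ← pow_add]
      congr 2
      omega
    rw [h1]
    have h2 : C / (1 - θ) * L q * θ ^ m ≤ C / (1 - θ) * expConv θ L q * θ ^ m :=
      mul_le_mul_of_nonneg_right (mul_le_mul_of_nonneg_left (le_expConv hθ.le hJ.nonneg q)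
        (div_nonneg hw.C_nonneg h1θ.le)) (pow_nonneg hθ.le m)
    linarith

/-- The oscillation of the averages of the diagonal function on the preimages of a point of the
basis. -/
theorem exists_abs_iterate_diag_sub_le {D ρ : ℝ}
    (hgap : ∀ ψ M, 0 ≤ M → (∀ x, |ψ x| ≤ M) → Y.Lip θ M ψ →
      ∃ e, ∀ m x, |(Y.avg w)^[m] ψ x - e| ≤ D * M * ρ ^ (m - Y.ht x)) (p : ℕ) (x : Δ) :
    ∃ a, ∀ y, Y.T y = x → |(Y.avg w)^[p] (fun z => J fun _ => z) y - a| ≤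
      expConvBack θ M L p + D * (2 + C / (1 - θ)) *
        ∑ q ∈ Finset.range p, expConv θ L q * ρ ^ ((p - q) - Y.ht y) := by
  have hθ := hw.θ_pos
  have hθ1 := hw.θ_lt_one
  have h1θ : 0 < 1 - θ := by linarith
  -- The reference point is itself a preimage of `x` of order `p + 1`: after time `p` its orbit
  -- coincides with that of every point averaged below.
  obtain ⟨w₀, hw₀⟩ : ∃ w₀, Y.T^[p + 1] w₀ = x := by
    obtain ⟨α⟩ := hw.nonempty_index x
    refine ⟨(Y.back α)^[p + 1] x, ?_⟩
    exact (Function.LeftInverse.iterate (fun x => Y.map_back α x) (p + 1)) x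
  set φ : ℕ → Δ → ℝ := fun q z => splice J w₀ (q + 1) z - splice J w₀ q z with hφ
  have hφL : ∀ q z, |φ q z| ≤ L q := fun q z => hJ.abs_splice_succ_sub_le_const w₀ z q
  have hC₂ : 1 ≤ 2 + C / (1 - θ) := by
    have := div_nonneg hw.C_nonneg h1θ.le
    linarith
  have hψ : ∀ q, ∃ e, ∀ m x, |(Y.avg w)^[m] ((Y.avg w)^[q] (φ q)) x - e| ≤
      D * ((2 + C / (1 - θ)) * expConv θ L q) * ρ ^ (m - Y.ht x) := fun q => by
    have hΛ := expConv_nonneg hθ.le hJ.nonneg q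
    refine hgap _ _ (by positivity) (fun z => ?_) (hJ.abs_increment_iterate_sub_le hw w₀ q)
    refine (hw.abs_iterate_le_of_forall (adm_of_bounded hw.c_pos (hφL q)) q
      fun z' _ => hφL q z').trans ((le_expConv hθ.le hJ.nonneg q).trans ?_)
    exact le_mul_of_one_le_left hΛ hC₂
  choose e he using hψ
  have hF : (fun z => J fun _ => z) =
      fun z => (∑ q ∈ Finset.range (max p M), φ q z) + J fun _ => w₀ := by
    funext z
    rw [hJ.diag_eq_splice w₀ (le_max_right p M) z, Finset.sum_range_sub (fun q => splice J w₀ q z),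
      splice_zero, sub_add_cancel]
  have hadm : ∀ q, Y.Adm c (φ q) := fun q => adm_of_bounded hw.c_pos (hφL q)
  have hsadm : Y.Adm c (fun z => ∑ q ∈ Finset.range (max p M), φ q z) :=
    adm_of_bounded hw.c_pos fun z => (Finset.abs_sum_le_sum_abs _ _).trans
      (Finset.sum_le_sum fun q _ => hφL q z)
  -- The centre collects the limits of the already mixed increments. It depends on `x` but not on
  -- the preimage `y`.
  refine ⟨(∑ q ∈ Finset.range p, e q) + J fun _ => w₀, fun y hy => ?_⟩
  rw [hF, hw.iterate_add hsadm (adm_const hw.c_pos _), hw.iterate_sum _ hadm, hw.iterate_const]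
  have hsplit : ∑ q ∈ Finset.range (max p M), (Y.avg w)^[p] (φ q) y =
      ∑ q ∈ Finset.range p, (Y.avg w)^[p] (φ q) y +
        ∑ q ∈ Finset.Ico p (max p M), (Y.avg w)^[p] (φ q) y :=
    (Finset.sum_range_add_sum_Ico _ (le_max_left p M)).symm
  -- For `q ≥ p`, the orbits of `z` and `w₀` agree on the window of radius `q - p` around time `q`,
  -- since they coincide from time `p + 1` on.
  have h1 : |∑ q ∈ Finset.Ico p (max p M), (Y.avg w)^[p] (φ q) y| ≤ expConvBack θ M L p := by
    rcases le_total M p with hp | hp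
    · rw [max_eq_left hp, Finset.Ico_self, Finset.sum_empty, abs_zero]
      exact expConvBack_nonneg hθ.le hJ.nonneg M p
    · rw [max_eq_right hp]
      refine (Finset.abs_sum_le_sum_abs _ _).trans (Finset.sum_le_sum fun q hq => ?_)
      refine hw.abs_iterate_le_of_forall (hadm q) p fun z hz => ?_
      refine hJ.abs_splice_succ_sub_le fun k _ hk => ?_
      have hpq := (Finset.mem_Ico.1 hq).1
      obtain ⟨i, rfl⟩ := Nat.exists_eq_add_of_lt (show p < k by omega)
      have hz' : Y.T^[p + 1] z = x := by rw [Function.iterate_succ_apply', hz, hy]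
      rw [show p + i + 1 = i + (p + 1) by ring, Function.iterate_add_apply,
        Function.iterate_add_apply Y.T i (p + 1) w₀, hz', hw₀]
      exact ⟨rfl, rfl⟩
  have h2 : |∑ q ∈ Finset.range p, ((Y.avg w)^[p] (φ q) y - e q)| ≤ D * (2 + C / (1 - θ)) *
        ∑ q ∈ Finset.range p, expConv θ L q * ρ ^ ((p - q) - Y.ht y) := by
    rw [Finset.mul_sum]
    refine (Finset.abs_sum_le_sum_abs _ _).trans (Finset.sum_le_sum fun q hq => ?_)
    have h3 := he q (p - q) y
    rw [← Function.iterate_add_apply, Nat.sub_add_cancel (Finset.mem_range.1 hq).le] at h3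
    exact h3.trans (le_of_eq (by ring))
  rw [Finset.sum_sub_distrib] at h2
  beta_reduce
  rw [hsplit]
  rw [abs_le] at h1 h2 ⊢
  constructor <;> linarith [h1.1, h1.2, h2.1, h2.2]

end IsOrbitLipschitz

/-! ### Exponential moments on the tower -/

/-- Both signs follow from `1 + v ≤ exp v`, applied at `v` and at `-v`. -/
theorem exp_le_one_add_add_sq_mul (v : ℝ) :
    Real.exp v ≤ 1 + v + v ^ 2 * Real.exp |v| := by
  have h0 := Real.add_one_le_exp v
  have h1 : Real.exp v * (1 - v) ≤ 1 := by
    have := mul_le_mul_of_nonneg_left (Real.add_one_le_exp (-v)) (Real.exp_pos v).le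
    rw [← Real.exp_add, add_neg_cancel, Real.exp_zero] at this
    linarith
  rcases le_total 0 v with hv | hv
  · rw [abs_of_nonneg hv]
    nlinarith [mul_le_mul_of_nonneg_left (show Real.exp v - 1 ≤ v * Real.exp v by linarith) hv]
  · have h2 : v ^ 2 * 1 ≤ v ^ 2 * Real.exp |v| :=
      mul_le_mul_of_nonneg_left (Real.one_le_exp (abs_nonneg v)) (sq_nonneg v)
    nlinarith [mul_le_mul_of_nonneg_left (show 1 - Real.exp v ≤ -v by linarith) (neg_nonneg.2 hv)]

namespace IsBackwardKernel

variable {Y : YoungTower Δ ι} {w : ι → Δ → ℝ} {θ C c K : ℝ} (hw : Y.IsBackwardKernel w θ C c K)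
include hw

/-- One step of the martingale estimate. -/
theorem avg_exp_le_exp_avg {u : Δ → ℝ} {B : ℝ} (hu : ∀ x, |u x| ≤ B) {x : Δ} {a A r : ℝ}
    {S : ℕ → ℝ} (hS : ∀ y, Y.T y = x → |u y - a| ≤ S (Y.ht y))
    (hS1 : ∀ h : ℕ, S h ≤ c / 2 * (1 + h)) (_hr : 0 ≤ r) (hr2 : r ^ 2 ≤ Real.exp (c / 2))
    (_hA : 0 ≤ A) (hS2 : ∀ h : ℕ, S h ≤ A * r ^ h) :
    Y.avg w (fun z => Real.exp (u z)) x ≤ Real.exp (Y.avg w u x + A ^ 2 * K) := by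
  have hK := hw.K_nonneg
  by_cases hx : Y.ht x = 0
  swap
  · obtain ⟨α⟩ := hw.nonempty_index x
    rw [hw.avg_of_ht_ne_zero hx _ α, hw.avg_of_ht_ne_zero hx _ α]
    exact Real.exp_le_exp.2 (le_add_of_nonneg_right (by positivity))
  have hc := hw.c_pos
  set v : Δ → ℝ := fun z => u z - a with hv
  have hvB : ∀ z, |v z| ≤ B + |a| := fun z => (abs_sub _ _).trans (add_le_add (hu z) le_rfl)
  have hva : Y.Adm c v := adm_of_bounded hc hvB
  have hRa : Y.Adm c (fun z => v z ^ 2 * Real.exp |v z|) :=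
    adm_of_bounded hc (B := (B + |a|) ^ 2 * Real.exp (B + |a|)) fun z => by
      rw [abs_of_nonneg (by positivity), ← sq_abs (v z)]
      exact mul_le_mul (pow_le_pow_left₀ (abs_nonneg _) (hvB z) 2) (Real.exp_le_exp.2 (hvB z))
        (Real.exp_pos _).le (by positivity)
  have hea : Y.Adm c (fun z => Real.exp (v z)) :=
    adm_of_bounded hc (B := Real.exp (B + |a|)) fun z => by
      rw [abs_of_pos (Real.exp_pos _)]
      exact Real.exp_le_exp.2 ((le_abs_self _).trans (hvB z))
  have hR : Y.avg w (fun z => v z ^ 2 * Real.exp |v z|) x ≤ A ^ 2 * K := by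
    have h1 := (hw.summable_moment x hx).mul_left (A ^ 2)
    refine le_trans ((hw.summable hRa x).tsum_le_tsum (fun α => ?_) h1) ?_
    · rw [mul_left_comm (A ^ 2)]
      refine mul_le_mul_of_nonneg_left ?_ (hw.nonneg α x)
      set y := Y.back α x with hy
      have hvy : |v y| ≤ S (Y.ht y) := hS y (Y.map_back α x)
      have hht : (Y.ht y : ℝ) + 1 = Y.φ α := by
        rw [hy, Y.ht_back_base α hx]
        exact_mod_cast Nat.sub_add_cancel (Y.φ_pos α)
      -- Half of the moment exponent `c` pays for `v ^ 2`, which grows like `r ^ (2 * ht)`. The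
      -- other half pays for `exp |v|`, through the linear bound on `S`.
      have h2 : v y ^ 2 ≤ A ^ 2 * Real.exp (c / 2 * Y.ht y) := by
        rw [← sq_abs, mul_comm (c / 2), Real.exp_nat_mul]
        calc |v y| ^ 2 ≤ (A * r ^ Y.ht y) ^ 2 :=
              pow_le_pow_left₀ (abs_nonneg _) (hvy.trans (hS2 _)) 2
          _ = A ^ 2 * (r ^ 2) ^ Y.ht y := by ring
          _ ≤ _ := mul_le_mul_of_nonneg_left (pow_le_pow_left₀ (by positivity) hr2 _)
              (sq_nonneg A)
      have h3 : Real.exp |v y| ≤ Real.exp (c / 2 * (1 + Y.ht y)) :=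
        Real.exp_le_exp.2 (hvy.trans (hS1 _))
      calc v y ^ 2 * Real.exp |v y|
          ≤ A ^ 2 * Real.exp (c / 2 * Y.ht y) * Real.exp (c / 2 * (1 + Y.ht y)) :=
            mul_le_mul h2 h3 (Real.exp_pos _).le (by positivity)
        _ ≤ A ^ 2 * Real.exp (c * Y.φ α) := by
            rw [mul_assoc, ← Real.exp_add]
            refine mul_le_mul_of_nonneg_left (Real.exp_le_exp.2 ?_) (sq_nonneg A)
            rw [← hht]
            nlinarith
    · rw [tsum_mul_left]
      exact mul_le_mul_of_nonneg_left (hw.moment_le x hx) (sq_nonneg A)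
  have hone : Y.Adm c (fun _ => (1 : ℝ)) := adm_const hc 1
  have h1 : Y.avg w (fun z => Real.exp (v z)) x ≤
      1 + Y.avg w v x + Y.avg w (fun z => v z ^ 2 * Real.exp |v z|) x := by
    have := hw.avg_mono hea ((hone.add hva).add hRa) (x := x)
      fun α => exp_le_one_add_add_sq_mul _
    rwa [hw.avg_add (hone.add hva) hRa, hw.avg_add hone hva, hw.avg_const] at this
  have h2 : Y.avg w v x = Y.avg w u x - a := by
    rw [hv, hw.avg_sub (adm_of_bounded hc hu) (adm_const hc a), hw.avg_const]
  have h3 : (fun z => Real.exp (u z)) = fun z => Real.exp a * Real.exp (v z) := by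
    funext z
    rw [← Real.exp_add, hv]
    congr 1
    ring
  rw [h3, avg_const_mul]
  calc _ ≤ Real.exp a * Real.exp (Y.avg w u x - a + A ^ 2 * K) := by
        refine mul_le_mul_of_nonneg_left (h1.trans ?_) (Real.exp_pos a).le
        have := Real.add_one_le_exp (Y.avg w u x - a + A ^ 2 * K)
        linarith
    _ = _ := by
        rw [← Real.exp_add]
        congr 1
        ring

variable [MeasurableSpace Δ] {μ : Measure Δ} [IsProbabilityMeasure μ]

/-- Exponential concentration on the tower, for small Lipschitz constants. -/
theorem exists_integral_exp_le_of_small (hap : ∀ k : ℕ, (∀ α, k ∣ Y.φ α) → k = 1)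
    (hmeas : ∀ ℓ f, Y.Lip θ ℓ f → Measurable f)
    (hinv : ∀ u B, Measurable u → (∀ x, |u x| ≤ B) → ∫ x, Y.avg w u x ∂μ = ∫ x, u x ∂μ) :
    ∃ (ε R : ℝ), 0 < ε ∧ 0 ≤ R ∧ ∀ M L J, Y.IsOrbitLipschitz θ M L J → (∀ j, L j ≤ ε) →
      ∫ x, Real.exp (J fun _ => x) ∂μ ≤
        Real.exp (∫ x, J (fun _ => x) ∂μ) * Real.exp (R * ∑ j ∈ Finset.range M, L j ^ 2) := by
  obtain ⟨ρ₀, D, hρ₀, hρ₀1, hD, hgap⟩ := hw.exists_gap hap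
  have hc := hw.c_pos
  have hK := hw.K_nonneg
  have hθ := hw.θ_pos
  have hθ1 := hw.θ_lt_one
  have h1θ : 0 < 1 - θ := by linarith
  -- The rate is slowed down so that the loss `ρ⁻¹` per unit of height, once squared, stays below
  -- `exp (c / 2)`.
  set ρ := max ρ₀ (Real.exp (-(c / 4))) with hρ
  have hρpos : 0 < ρ := hρ₀.trans_le (le_max_left _ _)
  have hρ1 : ρ < 1 := max_lt hρ₀1 (by rw [Real.exp_lt_one_iff]; linarith)
  have h1ρ : 0 < 1 - ρ := by linarith
  have hρc : ρ⁻¹ ^ 2 ≤ Real.exp (c / 2) := by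
    have : ρ⁻¹ ≤ Real.exp (c / 4) := by
      rw [inv_le_comm₀ hρpos (Real.exp_pos _), ← Real.exp_neg]
      exact le_max_right _ _
    calc ρ⁻¹ ^ 2 ≤ Real.exp (c / 4) ^ 2 := pow_le_pow_left₀ (by positivity) this 2
      _ = Real.exp (c / 2) := by rw [← Real.exp_nat_mul]; congr 1; push_cast; ring
  have hC₂ : 0 < D * (2 + C / (1 - θ)) := by
    have := div_nonneg hw.C_nonneg h1θ.le
    positivity
  set C₂ := D * (2 + C / (1 - θ)) with hC₂'
  -- With all `L j ≤ ε`, the oscillation at height `h` is at most `ε * Q * (1 + h)`; the threshold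
  -- `ε = c / (2 * Q)` makes the slope equal to `c / 2`.
  set Q := (1 - θ)⁻¹ * (1 + C₂ * (1 + (1 - ρ)⁻¹)) with hQ
  have hQ0 : 0 < Q := by positivity
  set R := K * (2 * (1 - θ)⁻¹ ^ 2 + 2 * C₂ ^ 2 * ((1 - ρ)⁻¹ ^ 2 * (1 - θ)⁻¹ ^ 2)) with hR
  refine ⟨c / (2 * Q), R, by positivity, by positivity, fun M L J hJ hL => ?_⟩
  set ε := c / (2 * Q) with hε
  have hε0 : 0 < ε := by positivity
  have hεQ : ε * Q = c / 2 := by rw [hε]; field_simp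
  set F : Δ → ℝ := fun z => J fun _ => z with hF
  obtain ⟨x₀⟩ : Nonempty Δ := μ.nonempty_of_neZero
  set B := max (|F x₀| + ∑ j ∈ Finset.range M, L j) (∑ j ∈ Finset.range M, L j * θ⁻¹ ^ j) with hB
  have hFB : ∀ x, |F x| ≤ B := fun x => by
    have h1 := hJ.abs_sub_le_const (fun _ => x) (fun _ => x₀)
    have h2 : |F x| ≤ |F x₀| + |F x - F x₀| := by
      have := abs_add_le (F x₀) (F x - F x₀)
      rwa [add_sub_cancel] at this
    exact h2.trans ((add_le_add le_rfl h1).trans (le_max_left _ _))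
  have hB0 : 0 ≤ B := (abs_nonneg _).trans (hFB x₀)
  have hFl : Y.Lip θ B F := fun m x y hm h => (hJ.lip_diag hθ hθ1 m x y hm h).trans
    (mul_le_mul_of_nonneg_right (le_max_right _ _) (pow_nonneg hθ.le m))
  set u : ℕ → Δ → ℝ := fun p => (Y.avg w)^[p] F with hu
  have hFa : Y.Adm c F := adm_of_bounded hc hFB
  have huB : ∀ p x, |u p x| ≤ B := fun p x =>
    hw.abs_iterate_le_of_forall hFa p fun z _ => hFB z
  have hum : ∀ p, Measurable (u p) := fun p => by
    refine hmeas (B + C / (1 - θ) * B) _ fun m x y hm h => ?_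
    refine (hw.abs_iterate_sub_le_of_bounded hB0 hFB (E := fun k => B * θ ^ k)
      (fun k x y hk h => hFl k x y hk h) p m x y hm h).trans ?_
    rw [add_mul]
    refine add_le_add (mul_le_mul_of_nonneg_left ?_ hB0) le_rfl
    exact pow_le_pow_of_le_one hθ.le hθ1.le (by omega)
  have husucc : ∀ p x, u (p + 1) x = Y.avg w (u p) x := fun p x => by
    simp only [hu, Function.iterate_succ_apply']
  have heB : ∀ p x, |Real.exp (u p x)| ≤ Real.exp B := fun p x => by
    rw [abs_of_pos (Real.exp_pos _)]
    exact Real.exp_le_exp.2 ((le_abs_self _).trans (huB p x))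
  have heint : ∀ p, Integrable (fun x => Real.exp (u p x)) μ := fun p =>
    Integrable.of_bound (hum p).exp.aestronglyMeasurable (Real.exp B)
      (Filter.Eventually.of_forall fun x => heB p x)
  set A : ℕ → ℝ := fun p => expConvBack θ M L p + C₂ * expConv ρ (expConv θ L) p with hA
  have hΛ := expConv_nonneg hθ.le hJ.nonneg
  have hA0 : ∀ p, 0 ≤ A p := fun p => add_nonneg (expConvBack_nonneg hθ.le hJ.nonneg M p)
    (mul_nonneg hC₂.le (expConv_nonneg hρpos.le hΛ p))
  have hstep : ∀ p x, Y.avg w (fun z => Real.exp (u p z)) x ≤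
      Real.exp (A p ^ 2 * K) * Real.exp (u (p + 1) x) := by
    intro p x
    obtain ⟨a, ha⟩ := hJ.exists_abs_iterate_diag_sub_le hw
      (fun ψ M hM h1 h2 => hgap ρ (le_max_left _ _) hρ1.le ψ M hM h1 h2) p x
    have h := hw.avg_exp_le_exp_avg (huB p) (x := x) (a := a) (A := A p) (r := ρ⁻¹)
      (S := fun h => expConvBack θ M L p +
        C₂ * ∑ q ∈ Finset.range p, expConv θ L q * ρ ^ ((p - q) - h)) ha (fun h => ?_)
      (by positivity) hρc (hA0 p) (fun h => ?_)
    · rw [husucc, ← Real.exp_add, add_comm]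
      exact h
    · have h1 := expConvBack_le hθ.le hθ1 hε0.le hL M p
      have h2 : ∑ q ∈ Finset.range p, expConv θ L q * ρ ^ ((p - q) - h) ≤
          ε / (1 - θ) * (h + (1 - ρ)⁻¹) := by
        refine le_trans ?_ (mul_le_mul_of_nonneg_left (sum_pow_sub_le hρpos.le hρ1 p h)
          (by positivity))
        rw [Finset.mul_sum]
        exact Finset.sum_le_sum fun q _ => mul_le_mul_of_nonneg_right
          (expConv_le hθ.le hθ1 hε0.le hL q) (pow_nonneg hρpos.le _)
      have h3 : 0 ≤ ε / (1 - θ) * (h + C₂ * ((1 - ρ)⁻¹ * h + 1)) := by positivity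
      calc _ ≤ ε / (1 - θ) + C₂ * (ε / (1 - θ) * (h + (1 - ρ)⁻¹)) :=
            add_le_add h1 (mul_le_mul_of_nonneg_left h2 hC₂.le)
        _ ≤ ε / (1 - θ) + C₂ * (ε / (1 - θ) * (h + (1 - ρ)⁻¹)) +
            ε / (1 - θ) * (h + C₂ * ((1 - ρ)⁻¹ * h + 1)) := le_add_of_nonneg_right h3
        _ = ε * Q * (1 + h) := by rw [hQ]; ring
        _ = _ := by rw [hεQ]
    · have h1 : ∑ q ∈ Finset.range p, expConv θ L q * ρ ^ ((p - q) - h) ≤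
          expConv ρ (expConv θ L) p * ρ⁻¹ ^ h := by
        -- The height is factored out using `ρ ^ (k - h) ≤ ρ ^ k * ρ⁻¹ ^ h`, valid for truncated
        -- subtraction because `ρ ≤ 1`.
        rw [expConv, Finset.sum_range_succ, add_mul, Finset.sum_mul]
        refine le_trans (Finset.sum_le_sum fun q _ => ?_)
          (le_add_of_nonneg_right (mul_nonneg (mul_nonneg (hΛ p) (by positivity)) (by positivity)))
        rw [mul_assoc]
        refine mul_le_mul_of_nonneg_left ?_ (hΛ q)
        rw [inv_pow, ← div_eq_mul_inv, le_div_iff₀ (pow_pos hρpos h), ← pow_add]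
        exact pow_le_pow_of_le_one hρpos.le hρ1.le (by omega)
      have h2 : expConvBack θ M L p ≤ expConvBack θ M L p * ρ⁻¹ ^ h :=
        le_mul_of_one_le_right (expConvBack_nonneg hθ.le hJ.nonneg M p)
          (one_le_pow₀ ((one_le_inv₀ hρpos).2 hρ1.le))
      calc _ ≤ expConvBack θ M L p * ρ⁻¹ ^ h +
            C₂ * (expConv ρ (expConv θ L) p * ρ⁻¹ ^ h) :=
            add_le_add h2 (mul_le_mul_of_nonneg_left h1 hC₂.le)
        _ = A p * ρ⁻¹ ^ h := by rw [hA]; ring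
  have hint : ∀ p, ∫ x, Real.exp (u p x) ∂μ ≤
      Real.exp (A p ^ 2 * K) * ∫ x, Real.exp (u (p + 1) x) ∂μ := fun p => by
    -- Invariance inserts one averaging for free, and the pointwise one-step estimate is then
    -- integrated.
    rw [← hinv _ _ (hum p).exp (heB p), ← integral_const_mul]
    refine integral_mono_of_nonneg (Filter.Eventually.of_forall fun x => ?_)
      ((heint (p + 1)).const_mul _) (Filter.Eventually.of_forall fun x => hstep p x)
    exact tsum_nonneg fun α => mul_nonneg (hw.nonneg α x) (Real.exp_pos _).le
  have hchain : ∀ P, ∫ x, Real.exp (F x) ∂μ ≤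
      Real.exp (K * ∑ p ∈ Finset.range P, A p ^ 2) * ∫ x, Real.exp (u P x) ∂μ := by
    intro P
    induction P with
    | zero => simp [hu]
    | succ P ih =>
      refine ih.trans ((mul_le_mul_of_nonneg_left (hint P) (Real.exp_pos _).le).trans
        (le_of_eq ?_))
      rw [← mul_assoc, ← Real.exp_add, Finset.sum_range_succ]
      congr 2
      ring
  have hsum : ∀ P, M ≤ P → K * ∑ p ∈ Finset.range P, A p ^ 2 ≤
      R * ∑ j ∈ Finset.range M, L j ^ 2 := by
    intro P hP
    have hLP : ∑ j ∈ Finset.range P, L j ^ 2 = ∑ j ∈ Finset.range M, L j ^ 2 := by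
      refine (Finset.sum_subset (Finset.range_mono hP) fun j _ hj => ?_).symm
      rw [hJ.eq_zero j (by simpa using hj), zero_pow two_ne_zero]
    have h1 := sum_expConvBack_sq_le (L := L) hθ.le hθ1 hP
    have h2 := sum_expConv_sq_le (L := L) hθ.le hθ1 P
    have h3 := sum_expConv_sq_le (L := expConv θ L) hρpos.le hρ1 P
    have h4 := h3.trans (mul_le_mul_of_nonneg_left h2 (by positivity))
    have h5 : ∑ p ∈ Finset.range P, A p ^ 2 ≤ 2 * ∑ p ∈ Finset.range P, expConvBack θ M L p ^ 2 +
        2 * C₂ ^ 2 * ∑ p ∈ Finset.range P, expConv ρ (expConv θ L) p ^ 2 := by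
      rw [Finset.mul_sum, Finset.mul_sum, ← Finset.sum_add_distrib]
      refine Finset.sum_le_sum fun p _ => ?_
      simp only [hA]
      nlinarith [sq_nonneg (expConvBack θ M L p - C₂ * expConv ρ (expConv θ L) p)]
    rw [hLP] at h1 h4
    rw [hR, mul_assoc]
    refine mul_le_mul_of_nonneg_left (h5.trans ?_) hK
    have h6 := mul_le_mul_of_nonneg_left h4 (show 0 ≤ 2 * C₂ ^ 2 by positivity)
    linarith
  obtain ⟨e, he⟩ := hgap ρ (le_max_left _ _) hρ1.le F B hB0 hFB hFl
  have hlim : ∀ x, Filter.Tendsto (fun P => u P x) Filter.atTop (nhds e) := fun x => by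
    rw [tendsto_iff_norm_sub_tendsto_zero]
    refine squeeze_zero (fun P => norm_nonneg _) (fun P => he P x) ?_
    rw [show (0 : ℝ) = D * B * 0 by ring]
    refine Filter.Tendsto.const_mul _ ?_
    exact (tendsto_pow_atTop_nhds_zero_of_lt_one hρpos.le hρ1).comp
      (Filter.tendsto_sub_atTop_nat _)
  -- Averaging preserves the integral, so the pointwise limit `e` of the uniformly bounded iterates
  -- is `∫ F`.
  have hI : ∫ x, F x ∂μ = e := by
    have h1 : ∀ P, ∫ x, u P x ∂μ = ∫ x, F x ∂μ := fun P => by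
      induction P with
      | zero => rfl
      | succ P ih => simp only [husucc]; rw [hinv _ _ (hum P) (huB P), ih]
    have h2 : Filter.Tendsto (fun P => ∫ x, u P x ∂μ) Filter.atTop (nhds (∫ _, e ∂μ)) :=
      tendsto_integral_of_dominated_convergence (fun _ => B)
        (fun P => (hum P).aestronglyMeasurable) (integrable_const B)
        (fun P => Filter.Eventually.of_forall fun x => huB P x)
        (Filter.Eventually.of_forall hlim)
    simp only [h1, integral_const, probReal_univ, smul_eq_mul, one_mul] at h2
    exact tendsto_nhds_unique tendsto_const_nhds h2
  have hE : Filter.Tendsto (fun P => ∫ x, Real.exp (u P x) ∂μ) Filter.atTop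
      (nhds (Real.exp e)) := by
    have h2 : Filter.Tendsto (fun P => ∫ x, Real.exp (u P x) ∂μ) Filter.atTop
        (nhds (∫ _, Real.exp e ∂μ)) :=
      tendsto_integral_of_dominated_convergence (fun _ => Real.exp B)
        (fun P => (hum P).exp.aestronglyMeasurable) (integrable_const _)
        (fun P => Filter.Eventually.of_forall fun x => heB P x)
        (Filter.Eventually.of_forall fun x => (Real.continuous_exp.tendsto e).comp (hlim x))
    simpa using h2
  rw [hI, mul_comm]
  refine ge_of_tendsto (hE.const_mul _) ?_
  filter_upwards [Filter.eventually_ge_atTop M] with P hP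
  exact (hchain P).trans (mul_le_mul_of_nonneg_right (Real.exp_le_exp.2 (hsum P hP))
    (integral_nonneg fun x => (Real.exp_pos _).le))

end IsBackwardKernel

/-! ### General Lipschitz constants -/

/-- A uniform error `s` is paid once in the exponential integral and once in the mean. This is used
both to freeze coordinates with large Lipschitz constants and to approximate on the natural
extension. -/
theorem integral_exp_le_of_abs_sub_le {X : Type*} [MeasurableSpace X] {μ : Measure X}
    [IsProbabilityMeasure μ] {F G : X → ℝ} {s t : ℝ} (hF : Integrable F μ) (hG : Integrable G μ)
    (heG : Integrable (fun x => Real.exp (G x)) μ) (h : ∀ x, |F x - G x| ≤ s)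
    (hle : ∫ x, Real.exp (G x) ∂μ ≤ Real.exp (∫ x, G x ∂μ) * Real.exp t) :
    ∫ x, Real.exp (F x) ∂μ ≤ Real.exp (∫ x, F x ∂μ) * Real.exp (t + 2 * s) := by
  have h1 : ∫ x, Real.exp (F x) ∂μ ≤ Real.exp s * ∫ x, Real.exp (G x) ∂μ := by
    rw [← integral_const_mul]
    refine integral_mono_of_nonneg (Filter.Eventually.of_forall fun x => (Real.exp_pos _).le)
      (heG.const_mul _) (Filter.Eventually.of_forall fun x => ?_)
    simp only [← Real.exp_add]
    exact Real.exp_le_exp.2 (by linarith [(abs_le.1 (h x)).2])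
  have h2 : ∫ x, G x ∂μ ≤ ∫ x, F x ∂μ + s := by
    have h3 : ∫ x, G x ∂μ ≤ ∫ x, (F x + s) ∂μ :=
      integral_mono hG (hF.add (integrable_const s)) fun x => by
        linarith [(abs_le.1 (h x)).1]
    rwa [integral_add hF (integrable_const s), integral_const, probReal_univ, one_smul] at h3
  calc _ ≤ Real.exp s * (Real.exp (∫ x, G x ∂μ) * Real.exp t) :=
        h1.trans (mul_le_mul_of_nonneg_left hle (Real.exp_pos s).le)
    _ ≤ Real.exp s * (Real.exp (∫ x, F x ∂μ + s) * Real.exp t) := by gcongr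
    _ = _ := by
        rw [← Real.exp_add, ← Real.exp_add, ← Real.exp_add]
        congr 1
        ring

namespace IsOrbitLipschitz

variable {Y : YoungTower Δ ι} {θ : ℝ} {M : ℕ} {L : ℕ → ℝ} {J : (ℕ → Δ) → ℝ}
  (hJ : Y.IsOrbitLipschitz θ M L J)
include hJ

theorem freeze (p : ℕ → Prop) [DecidablePred p] (x₀ : Δ) :
    Y.IsOrbitLipschitz θ M (fun j => if p j then L j else 0)
      (fun x => J fun j => if p j then x j else x₀) where
  nonneg j := by split_ifs; exacts [hJ.nonneg j, le_rfl]
  eq_zero j hj := by rw [hJ.eq_zero j hj, ite_self]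
  congr x y h := hJ.congr _ _ fun j hj => by rw [h j hj]
  abs_sub_le j r x z h := by
    by_cases hp : p j
    · have h1 : (fun i => if p i then Function.update x j z i else x₀) =
          Function.update (fun i => if p i then x i else x₀) j z := by
        funext i
        rcases eq_or_ne i j with rfl | hi
        · simp [hp]
        · simp [Function.update_of_ne hi]
      rw [h1, if_pos hp]
      exact hJ.abs_sub_le j r _ z (by simpa [hp] using h)
    · have h1 : (fun i => if p i then Function.update x j z i else x₀) =
          fun i => if p i then x i else x₀ := by
        funext i
        rcases eq_or_ne i j with rfl | hi
        · simp [hp]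
        · simp [Function.update_of_ne hi]
      rw [h1, sub_self, abs_zero, if_neg hp, zero_mul]

/-- Only coordinates with `L j > ε` move, and for these `L j ≤ L j ^ 2 / ε`. -/
theorem abs_sub_freeze_le {ε : ℝ} (hε : 0 < ε) (x₀ : Δ) (x : ℕ → Δ) :
    |J x - J (fun j => if L j ≤ ε then x j else x₀)| ≤
      ε⁻¹ * ∑ j ∈ Finset.range M, L j ^ 2 := by
  rw [Finset.mul_sum]
  refine hJ.abs_sub_le_sum _ _ fun j _ u hu => ?_
  have h0 := hJ.nonneg j
  by_cases hj : L j ≤ ε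
  · rw [if_pos hj, ← hu, Function.update_eq_self, sub_self, abs_zero]
    positivity
  · have h1 := hJ.abs_sub_le j 0 u (if L j ≤ ε then x j else x₀)
      fun k h1 h2 => absurd h1 (by omega)
    refine h1.trans ?_
    rw [pow_zero, mul_one, ← div_eq_inv_mul, le_div_iff₀ hε, sq]
    exact mul_le_mul_of_nonneg_left (le_of_not_ge hj) h0

theorem exists_abs_diag_le [Nonempty Δ] : ∃ B, ∀ x, |J fun _ => x| ≤ B := by
  obtain ⟨x₀⟩ := ‹Nonempty Δ›
  refine ⟨|J fun _ => x₀| + ∑ j ∈ Finset.range M, L j, fun x => ?_⟩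
  have h1 := hJ.abs_sub_le_const (fun _ => x) (fun _ => x₀)
  have h2 := abs_add_le (J fun _ => x₀) ((J fun _ => x) - J fun _ => x₀)
  rw [add_sub_cancel] at h2
  exact h2.trans (add_le_add le_rfl h1)

end IsOrbitLipschitz

/-- Exponential concentration on the tower. -/
theorem IsBackwardKernel.exists_integral_exp_le [MeasurableSpace Δ] {Y : YoungTower Δ ι}
    {w : ι → Δ → ℝ} {θ C c K : ℝ} (hw : Y.IsBackwardKernel w θ C c K)
    {μ : Measure Δ} [IsProbabilityMeasure μ] (hap : ∀ k : ℕ, (∀ α, k ∣ Y.φ α) → k = 1)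
    (hmeas : ∀ ℓ f, Y.Lip θ ℓ f → Measurable f)
    (hinv : ∀ u B, Measurable u → (∀ x, |u x| ≤ B) → ∫ x, Y.avg w u x ∂μ = ∫ x, u x ∂μ) :
    ∃ R : ℝ, 0 ≤ R ∧ ∀ M L J, Y.IsOrbitLipschitz θ M L J →
      ∫ x, Real.exp (J fun _ => x) ∂μ ≤
        Real.exp (∫ x, J (fun _ => x) ∂μ) * Real.exp (R * ∑ j ∈ Finset.range M, L j ^ 2) := by
  classical
  obtain ⟨ε, R, hε, hR, hsmall⟩ := hw.exists_integral_exp_le_of_small hap hmeas hinv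
  have hne : Nonempty Δ := μ.nonempty_of_neZero
  have x₀ := hne.some
  have hbd : ∀ M L J, Y.IsOrbitLipschitz θ M L J → Integrable (fun x => J fun _ => x) μ ∧
      Integrable (fun x => Real.exp (J fun _ => x)) μ := fun M L J hJ => by
    have hm : Measurable (fun x => J fun _ => x) := hmeas _ _ (hJ.lip_diag hw.θ_pos hw.θ_lt_one)
    obtain ⟨B, hB⟩ := hJ.exists_abs_diag_le
    refine ⟨Integrable.of_bound hm.aestronglyMeasurable B (Filter.Eventually.of_forall hB),
      Integrable.of_bound hm.exp.aestronglyMeasurable (Real.exp B)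
        (Filter.Eventually.of_forall fun x => ?_)⟩
    rw [Real.norm_eq_abs, abs_of_pos (Real.exp_pos _)]
    exact Real.exp_le_exp.2 ((le_abs_self _).trans (hB x))
  refine ⟨R + 2 * ε⁻¹, by positivity, fun M L J hJ => ?_⟩
  have hJ' := hJ.freeze (fun j => L j ≤ ε) x₀
  have h1 := hsmall M _ _ hJ' fun j => by
    split_ifs with h
    exacts [h, hε.le]
  have h2 : R * ∑ j ∈ Finset.range M, (if L j ≤ ε then L j else 0) ^ 2 ≤
      R * ∑ j ∈ Finset.range M, L j ^ 2 := by
    refine mul_le_mul_of_nonneg_left (Finset.sum_le_sum fun j _ => ?_) hR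
    split_ifs
    exacts [le_rfl, by rw [zero_pow two_ne_zero]; exact sq_nonneg _]
  have h3 := h1.trans (mul_le_mul_of_nonneg_left (Real.exp_le_exp.2 h2) (Real.exp_pos _).le)
  have h4 := integral_exp_le_of_abs_sub_le (hbd M L J hJ).1 (hbd M _ _ hJ').1 (hbd M _ _ hJ').2
    (fun x => hJ.abs_sub_freeze_le hε x₀ fun _ => x) h3
  refine h4.trans (le_of_eq ?_)
  congr 2
  ring

/-! ### Measurability -/

/-- Such a function is a uniform limit of functions depending on finitely many partition symbols,
and there are countably many finite itineraries, each defining a measurable set. -/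
theorem measurable_of_lip [MeasurableSpace Δ] [Countable ι] {Y : YoungTower Δ ι}
    (hT : Measurable Y.T) (hcell : ∀ α ℓ, MeasurableSet (Y.cell α ℓ)) {θ ℓ : ℝ} (hθ : 0 ≤ θ)
    (hθ1 : θ < 1) {f : Δ → ℝ} (hf : Y.Lip θ ℓ f) : Measurable f := by
  classical
  -- Itineraries have length `m + 1` because the Lipschitz condition requires at least one step of
  -- agreement.
  let code : (m : ℕ) → Δ → (Fin (m + 1) → ι × ℕ) :=
    fun m z k => (Y.col (Y.T^[k] z), Y.ht (Y.T^[k] z))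
  let approx : ℕ → Δ → ℝ := fun m z =>
    (fun d => if h : ∃ z, code m z = d then f h.choose else 0) (code m z)
  have hcode : ∀ m (d : Fin (m + 1) → ι × ℕ), MeasurableSet (code m ⁻¹' {d}) := fun m d => by
    have : code m ⁻¹' {d} = ⋂ k : Fin (m + 1), Y.T^[k] ⁻¹' Y.cell (d k).1 (d k).2 := by
      ext z
      simp only [code, mem_preimage, mem_singleton_iff, mem_iInter, cell, mem_ofPred_eq,
        funext_iff, Prod.ext_iff]
    rw [this]
    exact MeasurableSet.iInter fun k => (hT.iterate k) (hcell _ _)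
  refine measurable_of_tendsto_metrizable (f := approx) (fun m => ?_) ?_
  · let _ : MeasurableSpace (Fin (m + 1) → ι × ℕ) := ⊤
    have h1 : Measurable (code m) := measurable_to_countable' (hcode m)
    exact (measurable_from_top (f := fun d => if h : ∃ z, code m z = d then f h.choose else 0)).comp h1
  · rw [tendsto_pi_nhds]
    intro z
    rw [tendsto_iff_norm_sub_tendsto_zero]
    have hlim : Filter.Tendsto (fun m : ℕ => ℓ * θ ^ (m + 1)) Filter.atTop (nhds 0) := by
      rw [show (0 : ℝ) = ℓ * 0 by ring]
      exact ((tendsto_pow_atTop_nhds_zero_of_lt_one hθ hθ1).comp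
        (Filter.tendsto_add_atTop_nat 1)).const_mul ℓ
    refine squeeze_zero (fun m => norm_nonneg _) (fun m => ?_) hlim
    have hex : ∃ z', code m z' = code m z := ⟨z, rfl⟩
    simp only [approx, dif_pos hex]
    refine hf (m + 1) _ _ (by omega) fun k hk => ?_
    have := congrFun hex.choose_spec ⟨k, hk⟩
    simp only [code, Prod.mk.injEq] at this
    exact this

/-! ### The backward kernel of a uniform Young tower -/

theorem towerDist_le_pow {Y : YoungTower Δ ι} {β : ℝ} (hβ : 0 < β) (hβ1 : β < 1) {m : ℕ} {x y : Δ}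
    (h : Y.Agree m x y) : Y.towerDist β x y ≤ β ^ m := by
  rw [towerDist, symbolicDist]
  split_ifs with ht
  · exact pow_nonneg hβ.le m
  · refine pow_le_pow_of_le_one hβ.le hβ1.le ?_
    have h1 : (m : ℕ∞) ≤ Y.sepTime x y := le_iInf₂ fun n hn => by
      by_contra hlt
      exact hn (h n (by exact_mod_cast not_le.1 hlt))
    rw [← ENat.natCast_toNat ht] at h1
    exact_mod_cast h1

namespace IsUniform

variable [MeasurableSpace Δ] [Countable ι] {Y : YoungTower Δ ι} {μ : Measure Δ} {β : ℝ}
  (hY : Y.IsUniform μ β)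
include hY

theorem measurableSet_base : MeasurableSet Y.base := by
  have : Y.base = ⋃ α, Y.cell α 0 := by
    ext x
    simp [base, cell]
  rw [this]
  exact MeasurableSet.iUnion fun α => hY.measurableSet_cell α 0

theorem measurable_back (α : ι) : Measurable (Y.back α) := by
  intro B hB
  have himg : ∀ γ ℓ, MeasurableSet (Y.T '' (B ∩ Y.cell γ ℓ)) := fun γ ℓ =>
    hY.measurableSet_image γ ℓ _ inter_subset_right (hB.inter (hY.measurableSet_cell γ ℓ))
  have : Y.back α ⁻¹' B = (Y.base ∩ Y.T '' (B ∩ Y.cell α (Y.φ α - 1))) ∪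
      ⋃ γ, ⋃ ℓ, (Y.baseᶜ ∩ Y.T '' (B ∩ Y.cell γ ℓ)) := by
    ext x
    simp only [mem_preimage, mem_union, mem_inter_iff, mem_iUnion, mem_compl_iff]
    constructor
    · intro hx
      by_cases h0 : x ∈ Y.base
      · exact Or.inl ⟨h0, _, ⟨hx, Y.col_back_base α h0, Y.ht_back_base α h0⟩, Y.map_back α x⟩
      · exact Or.inr ⟨_, _, h0, _, ⟨hx, rfl, rfl⟩, Y.map_back α x⟩
    · rintro (⟨h0, y, ⟨hyB, hyc, _⟩, rfl⟩ | ⟨γ, ℓ, h0, y, ⟨hyB, _⟩, rfl⟩)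
      · rw [← hyc, Y.back_col_map]
        exact hyB
      · rw [Y.back_map_of_ht_ne_zero h0]
        exact hyB
  rw [this]
  exact (hY.measurableSet_base.inter (himg _ _)).union
    (MeasurableSet.iUnion fun γ => MeasurableSet.iUnion fun ℓ =>
      hY.measurableSet_base.compl.inter (himg γ ℓ))

omit [Countable ι] in
theorem measure_cell {α : ι} {ℓ : ℕ} (hℓ : ℓ < Y.φ α) : μ (Y.cell α ℓ) = μ (Y.cell α 0) := by
  induction ℓ with
  | zero => rfl
  | succ ℓ ih =>
    rw [← ih (by omega), ← hY.measurePreserving.measure_preimage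
      (hY.measurableSet_cell α (ℓ + 1)).nullMeasurableSet]
    congr 1
    ext y
    simp only [mem_preimage, cell, mem_ofPred_eq]
    constructor
    · rintro ⟨h1, h2⟩
      have h3 := Y.col_ht_map_of_lt (Y.ht_map_of_ne_zero (y := y) (by omega))
      exact ⟨h3.1.symm.trans h1, by omega⟩
    · rintro ⟨h1, h2⟩
      have h3 := Y.col_ht_map_of_lt (y := y) (by rw [h1, h2]; exact hℓ)
      exact ⟨h3.1.trans h1, by omega⟩

/-- Every point reaches the basis in finite time, so by invariance a null basis would make the whole
space null. -/
theorem measure_base_ne_zero : μ Y.base ≠ 0 := by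
  intro h0
  have := hY.isProbabilityMeasure
  have hcover : (univ : Set Δ) ⊆ ⋃ n : ℕ, Y.T^[n] ⁻¹' Y.base := by
    intro x _
    have key : ∀ n y, Y.φ (Y.col y) - Y.ht y ≤ n → ∃ m, Y.T^[m] y ∈ Y.base := by
      intro n
      induction n with
      | zero => intro y hy; have := Y.ht_lt y; omega
      | succ n ih =>
        intro y hy
        by_cases h : Y.ht (Y.T y) = 0
        · exact ⟨1, h⟩
        · have h1 := Y.col_ht_map_of_lt (Y.ht_map_of_ne_zero h)
          obtain ⟨m, hm⟩ := ih (Y.T y) (by rw [h1.1, h1.2]; omega)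
          exact ⟨m + 1, by rwa [Function.iterate_succ_apply]⟩
    obtain ⟨m, hm⟩ := key _ x le_rfl
    exact mem_iUnion.2 ⟨m, hm⟩
  have h1 : μ (⋃ n : ℕ, Y.T^[n] ⁻¹' Y.base) = 0 := measure_iUnion_null fun n => by
    rw [(hY.measurePreserving.iterate n).measure_preimage hY.measurableSet_base.nullMeasurableSet,
      h0]
  have h2 := measure_mono_null hcover h1
  simp at h2

variable {g : Δ → ℝ} (hg : Y.IsInverseJacobian μ g)
include hg

/-- Change of variables along an inverse branch. -/
theorem lintegral_base_back (α : ι) {f : Δ → ENNReal} (hf : Measurable f) :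
    ∫⁻ x in Y.base, ENNReal.ofReal (g (Y.back α x)) * f (Y.back α x) ∂μ =
      ∫⁻ y in Y.cell α (Y.φ α - 1), f y ∂μ := by
  set top := Y.cell α (Y.φ α - 1) with htop
  have hmt : MeasurableSet top := hY.measurableSet_cell _ _
  have hT := hY.measurePreserving.measurable
  have hginv : Measurable fun y => ENNReal.ofReal (1 / g y) :=
    (measurable_const.div hg.measurable).ennreal_ofReal
  have hmap : ((μ.restrict top).withDensity fun y => ENNReal.ofReal (1 / g y)).map Y.T =
      μ.restrict Y.base := by
    ext A hA
    rw [Measure.map_apply hT hA, withDensity_apply _ (hT hA), Measure.restrict_restrict (hT hA),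
      ← hg.measure_image α (Y.φ α - 1) _ inter_subset_right ((hT hA).inter hmt),
      Measure.restrict_apply hA]
    congr 1
    ext x
    constructor
    · rintro ⟨y, ⟨hy, hyt⟩, rfl⟩
      exact ⟨hy, (Y.bijOn_top α).mapsTo hyt⟩
    · rintro ⟨hx, hb⟩
      obtain ⟨y, hy, rfl⟩ := (Y.bijOn_top α).surjOn hb
      exact ⟨y, ⟨hx, hy⟩, rfl⟩
  have hgf : Measurable fun y => ENNReal.ofReal (g y) * f y := hg.measurable.ennreal_ofReal.mul hf
  have hgfb : Measurable fun x => ENNReal.ofReal (g (Y.back α x)) * f (Y.back α x) :=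
    hgf.comp (hY.measurable_back α)
  rw [← hmap, lintegral_map hgfb hT]
  refine (lintegral_withDensity_eq_lintegral_mul _ hginv (hgfb.comp hT)).trans ?_
  refine setLIntegral_congr_fun hmt fun y hy => ?_
  have hyb : Y.back α (Y.T y) = y := by
    rw [← hy.1, Y.back_col_map]
  simp only [Pi.mul_apply, Function.comp_apply, hyb]
  rw [← mul_assoc, ← ENNReal.ofReal_mul (by have := hg.pos y; positivity),
    one_div_mul_cancel (hg.pos y).ne', ENNReal.ofReal_one, one_mul]

omit hg in
theorem lintegral_tsum_top (f : Δ → ENNReal) :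
    ∑' α, ∫⁻ y in Y.cell α (Y.φ α - 1), f y ∂μ = ∫⁻ y in Y.T ⁻¹' Y.base, f y ∂μ := by
  have h1 : Y.T ⁻¹' Y.base = ⋃ α, Y.cell α (Y.φ α - 1) := by
    ext y
    simp only [mem_preimage, mem_iUnion, base, cell, mem_ofPred_eq]
    exact ⟨fun h => ⟨Y.col y, rfl, Y.ht_eq_of_ht_map_eq_zero h⟩,
      fun ⟨α, h2, h3⟩ => Y.ht_map_of_top (by rw [h2, h3])⟩
  rw [h1, lintegral_iUnion (fun α => hY.measurableSet_cell _ _)]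
  intro α γ hαγ
  rw [Function.onFun, Set.disjoint_left]
  rintro y ⟨h2, _⟩ ⟨h3, _⟩
  exact hαγ (h2.symm.trans h3)

/-- Integrating over a part `A` of the basis, the change of variables on each branch gives the
measure of `T⁻¹ A` inside the corresponding top cell; summing and using invariance gives `μ A`. -/
theorem ae_tsum_eq_one :
    ∀ᵐ x ∂(μ.restrict Y.base), ∑' α, ENNReal.ofReal (g (Y.back α x)) = 1 := by
  have := hY.isProbabilityMeasure
  have hT := hY.measurePreserving.measurable
  have hm : ∀ α, Measurable fun x => ENNReal.ofReal (g (Y.back α x)) := fun α =>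
    (hg.measurable.comp (hY.measurable_back α)).ennreal_ofReal
  refine ae_eq_of_forall_setLIntegral_eq_of_sigmaFinite (Measurable.tsum hm)
    measurable_const fun A hA _ => ?_
  have h1 : ∀ α, ∫⁻ x in A, ENNReal.ofReal (g (Y.back α x)) ∂(μ.restrict Y.base) =
      ∫⁻ y in Y.cell α (Y.φ α - 1), A.indicator 1 (Y.T y) ∂μ := fun α => by
    refine Eq.trans ?_ (hY.lintegral_base_back hg α ((measurable_one.indicator hA).comp hT))
    rw [← lintegral_indicator hA]
    refine lintegral_congr fun x => ?_
    rw [Y.map_back]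
    by_cases hx : x ∈ A <;> simp [hx]
  rw [lintegral_tsum fun α => (hm α).aemeasurable]
  simp only [h1]
  rw [hY.lintegral_tsum_top, hY.measurePreserving.setLIntegral_comp_preimage hY.measurableSet_base
    (measurable_one.indicator hA), lintegral_indicator hA]
  rfl

/-- The backward kernel associated to the inverse Jacobian `g`, normalized so that its values have
sum `1` everywhere; outside of the basis, it is taken constant. -/
theorem exists_isBackwardKernel (hexp : Y.HasExponentialTails μ) {C₀ : ℝ} (hC₀ : 0 ≤ C₀)
    (hdist : ∀ x y, Y.SameCell x y → |g x / g y - 1| ≤ C₀ * Y.towerDist β (Y.T x) (Y.T y))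
    {θ : ℝ} (hθ : β ≤ θ) (hθ1 : θ < 1) :
    ∃ w C c K, Y.IsBackwardKernel w θ C c K ∧
      ∀ᵐ x ∂(μ.restrict Y.base), ∀ α, w α x = g (Y.back α x) := by
  classical
  have := hY.isProbabilityMeasure
  have hβ := hY.β_pos
  have hβ1 := hY.β_lt_one
  have hae := hY.ae_tsum_eq_one hg
  have hbase := hY.measurableSet_base
  have : (ae (μ.restrict Y.base)).NeBot := by
    rw [ae_neBot, Ne, Measure.restrict_eq_zero]
    exact hY.measure_base_ne_zero
  obtain ⟨y₀, hy₀, hy₀b⟩ := (hae.and (ae_restrict_mem hbase)).exists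
  have hgpos : ∀ α x, 0 < g (Y.back α x) := fun α x => hg.pos _
  have hratio : ∀ m x y, Y.ht x = 0 → Y.ht y = 0 → Y.Agree m x y → ∀ α,
      g (Y.back α x) ≤ (1 + C₀ * β ^ m) * g (Y.back α y) := fun m x y hx hy h α => by
    have h1 := (abs_le.1 (hdist _ _ (sameCell_back_of_base hx hy α))).2
    rw [Y.map_back, Y.map_back] at h1
    have h2 := mul_le_mul_of_nonneg_left (towerDist_le_pow hβ hβ1 h) hC₀
    rw [← div_le_iff₀ (hgpos α y)]
    linarith
  have hagree0 : ∀ x y, Y.Agree 0 x y := fun x y k hk => absurd hk (Nat.not_lt_zero k)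
  have hsum : ∀ x, Y.ht x = 0 → Summable fun α => g (Y.back α x) := fun x hx => by
    have h1 : Summable fun α => g (Y.back α y₀) := by
      have h2 := ENNReal.summable_toReal (f := fun α => ENNReal.ofReal (g (Y.back α y₀)))
        (by rw [hy₀]; exact ENNReal.one_ne_top)
      simpa only [ENNReal.toReal_ofReal (hgpos _ _).le] using h2
    exact Summable.of_nonneg_of_le (fun α => (hgpos α x).le)
      (hratio 0 x y₀ hx hy₀b (hagree0 _ _)) (h1.mul_left _)
  have hι : Nonempty ι := ⟨Y.col y₀⟩
  set s : Δ → ℝ := fun x => ∑' α, g (Y.back α x) with hs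
  have hspos : ∀ x, Y.ht x = 0 → 0 < s x := fun x hx =>
    (hsum x hx).tsum_pos (fun α => (hgpos α x).le) hι.some (hgpos _ x)
  have hsratio : ∀ m x y, Y.ht x = 0 → Y.ht y = 0 → Y.Agree m x y →
      s x ≤ (1 + C₀ * β ^ m) * s y := fun m x y hx hy h => by
    rw [hs, ← tsum_mul_left]
    exact (hsum x hx).tsum_le_tsum (hratio m x y hx hy h) ((hsum y hy).mul_left _)
  -- The Jacobians sum to `1` only almost everywhere, whereas the kernel must be normalized at every
  -- point; hence the division by `s`. Off the basis the weights are those of the fixed base point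
  -- `y₀`, since all branches coincide there.
  set w : ι → Δ → ℝ := fun α x =>
    g (Y.back α (if Y.ht x = 0 then x else y₀)) / s (if Y.ht x = 0 then x else y₀) with hw
  have hwb : ∀ α x, Y.ht x = 0 → w α x = g (Y.back α x) / s x := fun α x hx => by
    simp only [hw, if_pos hx]
  have hwn : ∀ α x, Y.ht x ≠ 0 → w α x = w α y₀ := fun α x hx => by
    rw [hwb α y₀ hy₀b]
    simp only [hw, if_neg hx]
  have hw0 : ∀ α x, 0 ≤ w α x := fun α x => by
    by_cases hx : Y.ht x = 0
    · rw [hwb α x hx]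
      exact div_nonneg (hgpos α x).le (hspos x hx).le
    · rw [hwn α x hx, hwb α y₀ hy₀b]
      exact div_nonneg (hgpos α y₀).le (hspos y₀ hy₀b).le
  -- One factor comes from the numerator `g` and one from the normalization `s`.
  have hwratio : ∀ m x y, Y.ht x = 0 → Y.ht y = 0 → Y.Agree m x y → ∀ α,
      w α x ≤ (1 + C₀ * β ^ m) ^ 2 * w α y := fun m x y hx hy h α => by
    have hδ : 0 ≤ C₀ * β ^ m := by positivity
    rw [hwb α x hx, hwb α y hy, div_le_iff₀ (hspos x hx)]
    have h1 := hratio m x y hx hy h α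
    have h2 := hsratio m y x hy hx h.symm
    have h3 := hspos y hy
    calc g (Y.back α x) ≤ (1 + C₀ * β ^ m) * g (Y.back α y) := h1
      _ = (1 + C₀ * β ^ m) * (g (Y.back α y) / s y) * s y := by field_simp
      _ ≤ (1 + C₀ * β ^ m) * (g (Y.back α y) / s y) * ((1 + C₀ * β ^ m) * s x) := by
          refine mul_le_mul_of_nonneg_left h2 ?_
          exact mul_nonneg (by positivity) (div_nonneg (hgpos α y).le h3.le)
      _ = _ := by ring
  have hwone : ∀ x, HasSum (fun α => w α x) 1 := fun x => by
    have key : ∀ x, Y.ht x = 0 → HasSum (fun α => w α x) 1 := fun x hx => by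
      simp only [hwb _ x hx]
      have h1 := (hsum x hx).hasSum.div_const (s x)
      rwa [show (∑' α, g (Y.back α x)) / s x = 1 from div_self (hspos x hx).ne'] at h1
    by_cases hx : Y.ht x = 0
    · exact key x hx
    · simp only [hwn _ x hx]
      exact key y₀ hy₀b
  have hwae : ∀ᵐ x ∂(μ.restrict Y.base), ∀ α, w α x = g (Y.back α x) := by
    filter_upwards [hae, ae_restrict_mem hbase] with x hx hxb α
    rw [← ENNReal.ofReal_tsum_of_nonneg (fun α => (hgpos α x).le) (hsum x hxb),
      ENNReal.ofReal_eq_one] at hx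
    rw [hwb α x hxb, show s x = 1 from hx, div_one]
  have hone : ∀ m, 1 + C₀ * β ^ m ≤ 1 + C₀ := fun m => by
    have := mul_le_mul_of_nonneg_left (pow_le_one₀ hβ.le hβ1.le (n := m)) hC₀
    linarith
  obtain ⟨c, hc, hI⟩ := hexp
  set I := ∫⁻ x in Y.base, ENNReal.ofReal (Real.exp (c * (Y.φ (Y.col x) : ℝ))) ∂μ with hIdef
  have hIsum : I = ∑' α, ENNReal.ofReal (Real.exp (c * Y.φ α)) * μ (Y.cell α 0) := by
    have h1 : Y.base = ⋃ α, Y.cell α 0 := by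
      ext x
      simp [base, cell]
    rw [hIdef, h1, lintegral_iUnion (fun α => hY.measurableSet_cell α 0)]
    · refine tsum_congr fun α => ?_
      rw [← setLIntegral_const]
      refine setLIntegral_congr_fun (hY.measurableSet_cell α 0) fun x hx => ?_
      simp only [hx.1]
    · intro α γ hαγ
      rw [Function.onFun, Set.disjoint_left]
      rintro y ⟨h2, _⟩ ⟨h3, _⟩
      exact hαγ (h2.symm.trans h3)
  -- By distortion `w α x` is comparable to its average over the basis, which is the measure of the
  -- top cell of column `α` divided by `μ Y.base`; the cells of a column all have the same measure.
  -- Exponential tails thus become moments of the weights.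
  have hwle : ∀ α x, Y.ht x = 0 →
      ENNReal.ofReal (w α x) * μ Y.base ≤ ENNReal.ofReal ((1 + C₀) ^ 2) * μ (Y.cell α 0) := by
    intro α x hx
    have h1 := hY.lintegral_base_back hg α (f := fun _ => 1) measurable_const
    simp only [mul_one, setLIntegral_const, one_mul] at h1
    rw [← hY.measure_cell (Nat.sub_lt (Y.φ_pos α) one_pos), ← h1, ← setLIntegral_const,
      ← lintegral_const_mul' _ _ ENNReal.ofReal_ne_top]
    refine lintegral_mono_ae ?_
    filter_upwards [hwae, ae_restrict_mem hbase] with y hy hyb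
    rw [← hy, ← ENNReal.ofReal_mul (by positivity)]
    refine ENNReal.ofReal_le_ofReal ((hwratio 0 x y hx hyb (hagree0 _ _) α).trans ?_)
    rw [pow_zero, mul_one]
  have hmom : ∀ x, Y.ht x = 0 → ∑' α, ENNReal.ofReal (w α x * Real.exp (c * Y.φ α)) ≤
      ENNReal.ofReal ((1 + C₀) ^ 2) * I / μ Y.base := by
    intro x hx
    rw [ENNReal.le_div_iff_mul_le (Or.inl hY.measure_base_ne_zero)
      (Or.inl (measure_ne_top μ _)), ← ENNReal.tsum_mul_right, hIsum, ← ENNReal.tsum_mul_left]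
    refine ENNReal.tsum_le_tsum fun α => ?_
    rw [ENNReal.ofReal_mul (hw0 α x), mul_right_comm, mul_left_comm, mul_comm]
    exact mul_le_mul_right (hwle α x hx) _
  have hfin : ENNReal.ofReal ((1 + C₀) ^ 2) * I / μ Y.base ≠ ⊤ :=
    ENNReal.div_ne_top (ENNReal.mul_ne_top ENNReal.ofReal_ne_top hI.ne) hY.measure_base_ne_zero
  have hmomsum : ∀ x, Y.ht x = 0 → Summable fun α => w α x * Real.exp (c * Y.φ α) := by
    intro x hx
    have h2 := ENNReal.summable_toReal
      (f := fun α => ENNReal.ofReal (w α x * Real.exp (c * Y.φ α)))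
      (ne_top_of_le_ne_top hfin (hmom x hx))
    refine h2.congr fun α => ?_
    rw [ENNReal.toReal_ofReal (mul_nonneg (hw0 α x) (Real.exp_pos _).le)]
  refine ⟨w, (2 * C₀ + C₀ ^ 2) * (1 + C₀) ^ 2, c,
    (ENNReal.ofReal ((1 + C₀) ^ 2) * I / μ Y.base).toReal, ?_, hwae⟩
  constructor
  · exact hβ.trans_le hθ
  · exact hθ1
  · positivity
  · exact hc
  · exact ENNReal.toReal_nonneg
  · exact hw0
  · exact hwone
  · intro α m x y hm h
    have hθ0 : 0 ≤ θ := hβ.le.trans hθ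
    by_cases hx : Y.ht x = 0
    · have hy : Y.ht y = 0 := (h.sameCell hm).2 ▸ hx
      have h1 := hwratio m x y hx hy h α
      have h2 := hwratio m y x hy hx h.symm α
      have hwy := hw0 α y
      have hδ : 0 ≤ C₀ * β ^ m := by positivity
      have hδ2 : (1 + C₀ * β ^ m) ^ 2 - 1 ≤ (2 * C₀ + C₀ ^ 2) * θ ^ m := by
        have h3 : C₀ * β ^ m ≤ C₀ := by linarith [hone m]
        calc (1 + C₀ * β ^ m) ^ 2 - 1 = 2 * C₀ * β ^ m + C₀ * β ^ m * (C₀ * β ^ m) := by ring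
          _ ≤ 2 * C₀ * β ^ m + C₀ * (C₀ * β ^ m) := by gcongr
          _ = (2 * C₀ + C₀ ^ 2) * β ^ m := by ring
          _ ≤ _ := mul_le_mul_of_nonneg_left (pow_le_pow_left₀ hβ.le hθ m) (by positivity)
      have h4 : w α x ≤ (1 + C₀) ^ 2 * w α y := h1.trans
        (mul_le_mul_of_nonneg_right (pow_le_pow_left₀ (by positivity) (hone m) 2) hwy)
      have h5 : w α y ≤ (1 + C₀) ^ 2 * w α y :=
        le_mul_of_one_le_left hwy (one_le_pow₀ (by linarith))
      have h6 : 0 ≤ (2 * C₀ + C₀ ^ 2) * θ ^ m := by positivity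
      have key : ∀ a b : ℝ, 0 ≤ b → b ≤ (1 + C₀) ^ 2 * w α y → a ≤ (1 + C₀ * β ^ m) ^ 2 * b →
          a - b ≤ (2 * C₀ + C₀ ^ 2) * (1 + C₀) ^ 2 * θ ^ m * w α y := fun a b hb hb' hab => by
        calc a - b ≤ ((1 + C₀ * β ^ m) ^ 2 - 1) * b := by linarith
          _ ≤ (2 * C₀ + C₀ ^ 2) * θ ^ m * b := mul_le_mul_of_nonneg_right hδ2 hb
          _ ≤ (2 * C₀ + C₀ ^ 2) * θ ^ m * ((1 + C₀) ^ 2 * w α y) :=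
              mul_le_mul_of_nonneg_left hb' h6
          _ = _ := by ring
      rw [abs_le]
      constructor
      · linarith [key (w α y) (w α x) (hw0 α x) h4 h2]
      · exact key (w α x) (w α y) hwy h5 h1
    · have hy : Y.ht y ≠ 0 := (h.sameCell hm).2 ▸ hx
      rw [hwn α x hx, hwn α y hy, sub_self, abs_zero]
      have := hw0 α y₀
      positivity
  · intro α x y hx hy
    rw [hwn α x hx, hwn α y hy]
  · intro α
    have hpos : 0 < w α y₀ := by
      rw [hwb α y₀ hy₀b]
      exact div_pos (hgpos α y₀) (hspos y₀ hy₀b)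
    refine ⟨w α y₀ / (1 + C₀) ^ 2, by positivity, fun x => ?_⟩
    rw [div_le_iff₀ (by positivity)]
    by_cases hx : Y.ht x = 0
    · have := hwratio 0 y₀ x hy₀b hx (hagree0 _ _) α
      rw [pow_zero, mul_one] at this
      linarith
    · rw [hwn α x hx]
      exact le_mul_of_one_le_right hpos.le (one_le_pow₀ (by linarith))
  · exact hmomsum
  · intro x hx
    rw [← ENNReal.ofReal_le_iff_le_toReal hfin, ENNReal.ofReal_tsum_of_nonneg
      (fun α => mul_nonneg (hw0 α x) (Real.exp_pos _).le) (hmomsum x hx)]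
    exact hmom x hx

/-- The averaging operator preserves integrals. -/
theorem integral_avg {w : ι → Δ → ℝ} {θ C c K : ℝ} (hw : Y.IsBackwardKernel w θ C c K)
    (hwg : ∀ᵐ x ∂(μ.restrict Y.base), ∀ α, w α x = g (Y.back α x)) {u : Δ → ℝ} {B : ℝ}
    (hu : Measurable u) (hB : ∀ x, |u x| ≤ B) : ∫ x, Y.avg w u x ∂μ = ∫ x, u x ∂μ := by
  have := hY.isProbabilityMeasure
  have hT := hY.measurePreserving.measurable
  have hbase := hY.measurableSet_base
  have hne : Nonempty Δ := μ.nonempty_of_neZero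
  obtain ⟨α₀⟩ := hw.nonempty_index hne.some
  have hwm : ∀ α, Measurable (w α) := fun α => by
    refine measurable_of_lip hT hY.measurableSet_cell hw.θ_pos.le hw.θ_lt_one (ℓ := C)
      fun m x y hm h => (hw.distortion α m x y hm h).trans ?_
    refine mul_le_of_le_one_right (mul_nonneg hw.C_nonneg (pow_nonneg hw.θ_pos.le m)) ?_
    rw [← (hw.hasSum_one y).tsum_eq]
    exact (hw.hasSum_one y).summable.le_tsum α fun γ _ => hw.nonneg γ y
  have hdual : ∀ f : Δ → ENNReal, Measurable f →
      ∫⁻ x, ∑' α, ENNReal.ofReal (w α x) * f (Y.back α x) ∂μ = ∫⁻ x, f x ∂μ := by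
    intro f hf
    -- Points of the basis correspond to preimages in the top cells, the others to their unique
    -- preimage.
    rw [← lintegral_add_compl _ hbase, ← lintegral_add_compl f (hT hbase),
      ← hY.lintegral_tsum_top]
    congr 1
    · have hm : ∀ α, Measurable fun x => ENNReal.ofReal (w α x) * f (Y.back α x) := fun α =>
        (hwm α).ennreal_ofReal.mul (hf.comp (hY.measurable_back α))
      rw [lintegral_tsum fun α => (hm α).aemeasurable]
      refine tsum_congr fun α => ?_
      rw [← hY.lintegral_base_back hg α hf]
      refine lintegral_congr_ae ?_
      filter_upwards [hwg] with x hx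
      rw [hx]
    · have h1 : ∫⁻ x in Y.baseᶜ, ∑' α, ENNReal.ofReal (w α x) * f (Y.back α x) ∂μ =
          ∫⁻ x in Y.baseᶜ, f (Y.back α₀ x) ∂μ := by
        refine setLIntegral_congr_fun hbase.compl fun x hx => ?_
        simp only [fun γ => Y.back_eq_of_ht_ne_zero hx γ α₀]
        rw [ENNReal.tsum_mul_right, ← ENNReal.ofReal_tsum_of_nonneg (fun α => hw.nonneg α x)
          (hw.hasSum_one x).summable, (hw.hasSum_one x).tsum_eq, ENNReal.ofReal_one, one_mul]
      have h2 := hY.measurePreserving.setLIntegral_comp_preimage hbase.compl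
        (hf.comp (hY.measurable_back α₀))
      rw [preimage_compl] at h2
      refine h1.trans (h2.symm.trans ?_)
      refine setLIntegral_congr_fun (hT hbase).compl fun y hy => ?_
      rw [Function.comp_apply, Y.back_map_of_ht_ne_zero hy]
  have hua := adm_of_bounded hw.c_pos hB (Y := Y)
  have hBa := adm_const hw.c_pos B (Y := Y)
  -- Adding `B` makes the function nonnegative, so that the duality for lower Lebesgue integrals
  -- applies.
  have hv0 : ∀ x, 0 ≤ u x + B := fun x => by linarith [(abs_le.1 (hB x)).1]
  have hvm : Measurable fun x => u x + B := hu.add measurable_const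
  have htsum : ∀ x, ENNReal.ofReal (Y.avg w (fun x => u x + B) x) =
      ∑' α, ENNReal.ofReal (w α x) * ENNReal.ofReal (u (Y.back α x) + B) := fun x => by
    rw [avg, ENNReal.ofReal_tsum_of_nonneg (fun α => mul_nonneg (hw.nonneg α x) (hv0 _))
      (hw.summable (hua.add hBa) x)]
    exact tsum_congr fun α => ENNReal.ofReal_mul (hw.nonneg α x)
  have havg0 : ∀ x, 0 ≤ Y.avg w (fun x => u x + B) x := fun x =>
    tsum_nonneg fun α => mul_nonneg (hw.nonneg α x) (hv0 _)
  have havgm : Measurable (Y.avg w fun x => u x + B) := by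
    have h1 : Measurable fun x =>
        ∑' α, ENNReal.ofReal (w α x) * ENNReal.ofReal (u (Y.back α x) + B) :=
      Measurable.tsum fun α => (hwm α).ennreal_ofReal.mul
        (hvm.comp (hY.measurable_back α)).ennreal_ofReal
    have h2 : (Y.avg w fun x => u x + B) = fun x =>
        (∑' α, ENNReal.ofReal (w α x) * ENNReal.ofReal (u (Y.back α x) + B)).toReal := by
      funext x
      rw [← htsum, ENNReal.toReal_ofReal (havg0 x)]
    rw [h2]
    exact h1.ennreal_toReal
  have h1 : ∫ x, Y.avg w (fun x => u x + B) x ∂μ = ∫ x, (u x + B) ∂μ := by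
    rw [integral_eq_lintegral_of_nonneg_ae (Filter.Eventually.of_forall havg0)
      havgm.aestronglyMeasurable, integral_eq_lintegral_of_nonneg_ae
      (Filter.Eventually.of_forall hv0) hvm.aestronglyMeasurable]
    simp only [htsum]
    rw [hdual _ hvm.ennreal_ofReal]
  have h2 : Y.avg w (fun x => u x + B) = fun x => Y.avg w u x + B := by
    funext x
    rw [hw.avg_add hua hBa, hw.avg_const]
  have h3 : Integrable (Y.avg w u) μ := by
    refine Integrable.of_bound (C := B) ?_ (Filter.Eventually.of_forall fun x => ?_)
    · rw [h2] at havgm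
      have := havgm.sub_const B
      simp only [add_sub_cancel_right] at this
      exact this.aestronglyMeasurable
    · exact hw.abs_iterate_le_of_forall hua 1 fun z _ => hB z
  rw [h2, integral_add h3 (integrable_const B), integral_add (Integrable.of_bound
    hu.aestronglyMeasurable B (Filter.Eventually.of_forall hB)) (integrable_const B)] at h1
  exact add_right_cancel h1

end IsUniform

/-! ### The natural extension -/

section natExt

variable {Y : YoungTower Δ ι}

/-- The bi-infinite orbit of `z` obtained by extending it to the past along a fixed branch. -/
noncomputable def extend (Y : YoungTower Δ ι) (α : ι) (z : Δ) : Y.NatExt :=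
  ⟨fun n => match n with
    | Int.ofNat k => Y.T^[k] z
    | Int.negSucc k => (Y.back α)^[k + 1] z, by
    rintro (k | k)
    · exact Function.iterate_succ_apply' Y.T k z
    · cases k with
      | zero => exact (Y.map_back α z).symm
      | succ k =>
        change (Y.back α)^[k + 1] z = Y.T ((Y.back α)^[k + 1 + 1] z)
        rw [Function.iterate_succ_apply' _ (k + 1), Y.map_back]⟩

theorem coord_extend (α : ι) (z : Δ) (k : ℕ) : Y.coord k (Y.extend α z) = Y.T^[k] z := rfl

theorem iterate_coord (x : Y.NatExt) (n : ℤ) (k : ℕ) :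
    Y.T^[k] (Y.coord n x) = Y.coord (n + k) x := by
  induction k with
  | zero => simp
  | succ k ih =>
    rw [Function.iterate_succ_apply', ih, Nat.cast_succ, ← add_assoc]
    exact (x.2 (n + k)).symm

theorem coord_iterate_natMap (x : Y.NatExt) (n : ℤ) (k : ℕ) :
    Y.coord n (Y.natMap^[k] x) = Y.coord (n + k) x := by
  rw [← iterate_coord]
  induction k with
  | zero => rfl
  | succ k ih =>
    rw [Function.iterate_succ_apply', Function.iterate_succ_apply', ← ih]
    rfl

/-- Nonnegative times are given by the orbits. The window reaches the artificial past only when it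
contains time `0`; then `z` and `z'` share a cell, and so do their preimages along the fixed branch.
-/
theorem sameCell_coord_extend {α : ι} {z z' : Δ} {j r : ℕ} (h : Y.AgreeAround j r z z') {k : ℤ}
    (hk : k.natAbs < r) : Y.SameCell (Y.coord k (Y.natMap^[j] (Y.extend α z)))
      (Y.coord k (Y.natMap^[j] (Y.extend α z'))) := by
  rw [coord_iterate_natMap, coord_iterate_natMap]
  rcases hn : k + (j : ℤ) with n | n
  · rw [Int.ofNat_eq_natCast] at hn ⊢
    rw [coord_extend, coord_extend]
    exact h n (by omega) (by omega)
  · have h0 : Y.SameCell z z' := h 0 (by omega) (by omega)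
    change Y.SameCell ((Y.back α)^[n + 1] z) ((Y.back α)^[n + 1] z')
    generalize n + 1 = m
    induction m with
    | zero => exact h0
    | succ m ih =>
      rw [Function.iterate_succ_apply', Function.iterate_succ_apply']
      exact ih.back α

theorem bilateralDist_nonneg {β : ℝ} (hβ : 0 < β) (x y : Y.NatExt) :
    0 ≤ Y.bilateralDist β x y := by
  rw [bilateralDist, symbolicDist]
  split_ifs
  exacts [le_rfl, pow_nonneg hβ.le _]

theorem bilateralDist_le_pow {β : ℝ} (hβ : 0 < β) (hβ1 : β < 1) {r : ℕ} {x y : Y.NatExt}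
    (h : ∀ k : ℤ, k.natAbs < r → Y.SameCell (Y.coord k x) (Y.coord k y)) :
    Y.bilateralDist β x y ≤ β ^ r := by
  rw [bilateralDist, symbolicDist]
  split_ifs with ht
  · exact pow_nonneg hβ.le r
  · refine pow_le_pow_of_le_one hβ.le hβ1.le ?_
    have h1 : (r : ℕ∞) ≤ Y.bilateralSepTime x y := le_iInf₂ fun n hn => by
      by_contra hlt
      exact hn (h n (by exact_mod_cast not_le.1 hlt))
    rw [← ENat.natCast_toNat ht] at h1
    exact_mod_cast h1

/-- The artificial past begins before time `-N`, hence outside the window of radius `N` around each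
time `i ≥ 0`. -/
theorem bilateralDist_extend_le {β : ℝ} (hβ : 0 < β) (hβ1 : β < 1) (α : ι) (x : Y.NatExt)
    (N i : ℕ) : Y.bilateralDist β (Y.natMap^[i] x)
      (Y.natMap^[N + i] (Y.extend α (Y.coord (-N) x))) ≤ β ^ N := by
  refine bilateralDist_le_pow hβ hβ1 fun k hk => ?_
  rw [coord_iterate_natMap, coord_iterate_natMap]
  obtain ⟨n, hn⟩ := Int.eq_ofNat_of_zero_le (show 0 ≤ k + ((N + i : ℕ) : ℤ) by omega)
  rw [hn, coord_extend, iterate_coord, ← hn, show -(N : ℤ) + (k + ((N + i : ℕ) : ℤ)) = k + i by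
    push_cast; ring]
  exact ⟨rfl, rfl⟩

theorem measurable_coord [MeasurableSpace Δ] (n : ℤ) : Measurable (Y.coord n) :=
  (measurable_pi_apply n).comp measurable_subtype_coe

theorem IsNatExtMeasure.map_coord_neg [MeasurableSpace Δ] {μ : Measure Δ} {μZ : Measure Y.NatExt}
    (h : Y.IsNatExtMeasure μ μZ) (N : ℕ) : μZ.map (Y.coord (-N)) = μ := by
  have h1 := h.measurePreserving.iterate N
  have h2 : Y.coord 0 = Y.coord (-N) ∘ Y.natMap^[N] := by
    funext x
    rw [Function.comp_apply, coord_iterate_natMap, neg_add_cancel]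
  rw [← h.map_coord_zero, h2, ← Measure.map_map (measurable_coord _) h1.measurable, h1.map_eq]

end natExt

end YoungTower

/-! ### Separately Lipschitz functions, with constants of arbitrary sign -/

namespace SeparatelyLipschitz

variable {X : Type*} {d : X → X → ℝ} {n : ℕ} {K : (Fin n → X) → ℝ} {L : Fin n → ℝ}

theorem abs_sub_update_le (hK : SeparatelyLipschitz d K L) (hd : ∀ x y, 0 ≤ d x y) (i : Fin n)
    (x : Fin n → X) (z : X) : |K x - K (Function.update x i z)| ≤ |L i| * d (x i) z :=
  (hK i x z).trans (mul_le_mul_of_nonneg_right (le_abs_self _) (hd _ _))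

theorem abs_sub_le (hK : SeparatelyLipschitz d K L) (hd : ∀ x y, 0 ≤ d x y) (x y : Fin n → X) :
    |K x - K y| ≤ ∑ i, |L i| * d (x i) (y i) := by
  classical
  have key : ∀ s : Finset (Fin n), |K x - K (fun i => if i ∈ s then y i else x i)| ≤
      ∑ i ∈ s, |L i| * d (x i) (y i) := by
    intro s
    induction s using Finset.induction_on with
    | empty => simp
    | insert a s ha ih =>
      have h1 := hK.abs_sub_update_le hd a (fun i => if i ∈ s then y i else x i) (y a)
      have h2 : Function.update (fun i => if i ∈ s then y i else x i) a (y a) =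
          fun i => if i ∈ insert a s then y i else x i := by
        funext i
        rcases eq_or_ne i a with rfl | hi
        · simp
        · simp [hi]
      rw [h2] at h1
      simp only [ha, if_false] at h1
      rw [Finset.sum_insert ha, add_comm]
      exact (_root_.abs_sub_le _ _ _).trans (add_le_add ih h1)
  simpa using key Finset.univ

end SeparatelyLipschitz

namespace YoungTower

variable {Δ ι : Type*}

/-- A separately Lipschitz function on the natural extension, evaluated along the orbits obtained
by extending points of the tower to the past. -/
theorem isOrbitLipschitz_extend {Y : YoungTower Δ ι} {β θ : ℝ} (hβ : 0 < β) (hβ1 : β < 1)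
    (hθ : β ≤ θ) (α : ι) {n : ℕ} {K : (Fin n → Y.NatExt) → ℝ} {L : Fin n → ℝ}
    (hK : SeparatelyLipschitz (Y.bilateralDist β) K L) (N : ℕ) :
    Y.IsOrbitLipschitz θ (N + n)
      (fun j => if h : N ≤ j ∧ j < N + n then |L ⟨j - N, by omega⟩| else 0)
      (fun x => K fun i => Y.natMap^[N + i] (Y.extend α (x (N + i)))) where
  nonneg j := by split_ifs; exacts [abs_nonneg _, le_rfl]
  eq_zero j hj := dif_neg (by omega)
  congr x y h := by
    congr 1
    funext i
    rw [h (N + i) (by omega)]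
  abs_sub_le j r x z h := by
    by_cases hj : N ≤ j ∧ j < N + n
    · have h1 : (fun i : Fin n => Y.natMap^[N + i] (Y.extend α (Function.update x j z (N + i)))) =
          Function.update (fun i : Fin n => Y.natMap^[N + i] (Y.extend α (x (N + i))))
            ⟨j - N, by omega⟩ (Y.natMap^[j] (Y.extend α z)) := by
        funext i
        rcases eq_or_ne i ⟨j - N, by omega⟩ with rfl | hi
        · have : N + (j - N) = j := by omega
          simp [this]
        · have : N + (i : ℕ) ≠ j := fun h => hi (Fin.ext (by simp; omega))
          rw [Function.update_of_ne hi, Function.update_of_ne this]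
      rw [h1, dif_pos hj]
      refine (hK.abs_sub_update_le (bilateralDist_nonneg hβ) _ _ _).trans
        (mul_le_mul_of_nonneg_left ?_ (abs_nonneg _))
      refine le_trans ?_ (pow_le_pow_left₀ hβ.le hθ r)
      have : N + (j - N) = j := by omega
      simp only [this]
      exact bilateralDist_le_pow hβ hβ1 fun k hk => sameCell_coord_extend h hk
    · have h1 : (fun i : Fin n => Y.natMap^[N + i] (Y.extend α (Function.update x j z (N + i)))) =
          fun i : Fin n => Y.natMap^[N + i] (Y.extend α (x (N + i))) := by
        funext i
        rw [Function.update_of_ne (by omega)]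
      rw [h1, sub_self, abs_zero, dif_neg hj, zero_mul]

end YoungTower

open YoungTower in
theorem mainTheorem7 {Δ ι : Type*} [MeasurableSpace Δ] [Countable ι]
    (Y : YoungTower Δ ι) (μ : Measure Δ) (β : ℝ)
    (hY : Y.IsUniform μ β) (hexp : Y.HasExponentialTails μ)
    (μZ : Measure Y.NatExt) (hμZ : Y.IsNatExtMeasure μ μZ)
    (βZ : ℝ) (hβZ : 0 < βZ) (hβZ_lt : βZ < 1) :
    ExponentialConcentration (Y.bilateralDist βZ) Y.natMap μZ := by
  have := hY.isProbabilityMeasure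
  obtain ⟨g, hg, C₀, hdist⟩ := hY.distortion
  -- One rate dominates both the distortion of the tower and the distance on the natural extension,
  -- whose parameters are unrelated.
  set θ := max β βZ with hθ
  have hθ0 : 0 < θ := hβZ.trans_le (le_max_right _ _)
  have hθ1 : θ < 1 := max_lt hY.β_lt_one hβZ_lt
  have hdist' : ∀ x y, Y.SameCell x y →
      |g x / g y - 1| ≤ max C₀ 0 * Y.towerDist β (Y.T x) (Y.T y) := fun x y h => by
    refine (hdist x y h).trans (mul_le_mul_of_nonneg_right (le_max_left _ _) ?_)
    rw [towerDist, symbolicDist]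
    split_ifs
    exacts [le_rfl, pow_nonneg hY.β_pos.le _]
  obtain ⟨w, C, c, K', hw, hwg⟩ := hY.exists_isBackwardKernel hg hexp (le_max_right C₀ 0) hdist'
    (le_max_left β βZ) hθ1
  have hmeas : ∀ ℓ f, Y.Lip θ ℓ f → Measurable f := fun ℓ f hf =>
    measurable_of_lip hY.measurePreserving.measurable hY.measurableSet_cell hθ0.le hθ1 hf
  obtain ⟨R, hR, hconc⟩ := hw.exists_integral_exp_le hY.aperiodic hmeas
    fun u B hu hB => hY.integral_avg hg hw hwg hu hB
  have : IsProbabilityMeasure μZ := by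
    refine ⟨?_⟩
    have h1 : μZ.map (Y.coord 0) univ = 1 := by rw [hμZ.map_coord_zero, measure_univ]
    rwa [Measure.map_apply (measurable_coord 0) MeasurableSet.univ, preimage_univ] at h1
  have hne : Nonempty Y.NatExt := μZ.nonempty_of_neZero
  have x₀ := hne.some
  obtain ⟨α⟩ := hw.nonempty_index (Y.coord 0 x₀)
  -- The summand `1` only ensures positivity, since `R` may vanish.
  refine ⟨R + 1, by positivity, fun n K L hK => ?_⟩
  set Ψ : Y.NatExt → ℝ := fun x => K fun i => Y.natMap^[i] x with hΨ
  set J : ℕ → (ℕ → Δ) → ℝ := fun N x =>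
    K fun i => Y.natMap^[N + i] (Y.extend α (x (N + i))) with hJdef
  have hJ := fun N => isOrbitLipschitz_extend hβZ hβZ_lt (le_max_right β βZ) α hK N
  -- The approximation depends on the single coordinate `-N`, whose law is `μ`. In `J N` the
  -- original variables sit at times `N, …, N + n - 1`, so `∑ L i ^ 2` does not depend on `N`.
  set G : ℕ → Y.NatExt → ℝ := fun N x => J N fun _ => Y.coord (-N) x with hG
  have hsum : ∀ N, ∑ j ∈ Finset.range (N + n),
      (if h : N ≤ j ∧ j < N + n then |L ⟨j - N, by omega⟩| else 0) ^ 2 = ∑ i, L i ^ 2 := by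
    intro N
    rw [Finset.sum_range_add, Finset.sum_eq_zero fun j hj => ?_, zero_add, Finset.sum_range]
    · refine Finset.sum_congr rfl fun i _ => ?_
      rw [dif_pos ⟨by omega, by omega⟩, sq_abs]
      congr 2
      exact Fin.ext (by simp)
    · rw [dif_neg (by have := Finset.mem_range.1 hj; omega), zero_pow two_ne_zero]
  have hFm : ∀ N, Measurable fun z => J N fun _ => z := fun N =>
    hmeas _ _ ((hJ N).lip_diag hθ0 hθ1)
  have hGm : ∀ N, Measurable (G N) := fun N => (hFm N).comp (measurable_coord _)
  have hs : ∀ N x, |Ψ x - G N x| ≤ (∑ i, |L i|) * βZ ^ N := fun N x => by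
    refine (hK.abs_sub_le (bilateralDist_nonneg hβZ) _ _).trans ?_
    rw [Finset.sum_mul]
    exact Finset.sum_le_sum fun i _ => mul_le_mul_of_nonneg_left
      (bilateralDist_extend_le hβZ hβZ_lt α x N i) (abs_nonneg _)
  have hslim : Filter.Tendsto (fun N : ℕ => (∑ i, |L i|) * βZ ^ N) Filter.atTop (nhds 0) := by
    have := (tendsto_pow_atTop_nhds_zero_of_lt_one hβZ.le hβZ_lt).const_mul (∑ i, |L i|)
    rwa [mul_zero] at this
  have hΨm : Measurable Ψ := by
    refine measurable_of_tendsto_metrizable hGm (tendsto_pi_nhds.2 fun x => ?_)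
    rw [tendsto_iff_norm_sub_tendsto_zero]
    refine squeeze_zero (fun N => norm_nonneg _) (fun N => ?_) hslim
    rw [norm_sub_rev]
    exact hs N x
  have hbdd : ∀ f : Y.NatExt → ℝ, Measurable f → (∃ B, ∀ x, |f x| ≤ B) →
      Integrable f μZ ∧ Integrable (fun x => Real.exp (f x)) μZ := by
    rintro f hf ⟨B, hB⟩
    refine ⟨Integrable.of_bound hf.aestronglyMeasurable B (Filter.Eventually.of_forall hB),
      Integrable.of_bound hf.exp.aestronglyMeasurable (Real.exp B)
        (Filter.Eventually.of_forall fun x => ?_)⟩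
    rw [Real.norm_eq_abs, abs_of_pos (Real.exp_pos _)]
    exact Real.exp_le_exp.2 ((le_abs_self _).trans (hB x))
  have hΔ : Nonempty Δ := ⟨Y.coord 0 x₀⟩
  have hGb : ∀ N, ∃ B, ∀ x, |G N x| ≤ B := fun N => by
    obtain ⟨B, hB⟩ := (hJ N).exists_abs_diag_le
    exact ⟨B, fun x => hB _⟩
  have hΨb : ∃ B, ∀ x, |Ψ x| ≤ B := by
    obtain ⟨B, hB⟩ := hGb 0
    refine ⟨B + (∑ i, |L i|) * βZ ^ 0, fun x => ?_⟩
    have h1 := abs_add_le (G 0 x) (Ψ x - G 0 x)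
    rw [add_sub_cancel] at h1
    exact h1.trans (add_le_add (hB x) (hs 0 x))
  obtain ⟨hΨi, hΨe⟩ := hbdd Ψ hΨm hΨb
  refine ⟨hΨi, hΨe, ?_⟩
  have hN : ∀ N : ℕ, ∫ x, Real.exp (Ψ x) ∂μZ ≤ Real.exp (∫ x, Ψ x ∂μZ) *
      Real.exp (R * ∑ i, L i ^ 2 + 2 * ((∑ i, |L i|) * βZ ^ N)) := fun N => by
    obtain ⟨hGi, hGe⟩ := hbdd (G N) (hGm N) (hGb N)
    refine integral_exp_le_of_abs_sub_le hΨi hGi hGe (hs N) ?_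
    have h1 := hconc _ _ _ (hJ N)
    rw [hsum N, ← hμZ.map_coord_neg N, integral_map (measurable_coord _).aemeasurable
      (hFm N).exp.aestronglyMeasurable, integral_map (measurable_coord _).aemeasurable
      (hFm N).aestronglyMeasurable] at h1
    exact h1
  -- Because `R` is independent of `N`, only the approximation error depends on it, and this error
  -- vanishes in the limit.
  have hlim : Filter.Tendsto (fun N : ℕ => Real.exp (∫ x, Ψ x ∂μZ) *
      Real.exp (R * ∑ i, L i ^ 2 + 2 * ((∑ i, |L i|) * βZ ^ N))) Filter.atTop
      (nhds (Real.exp (∫ x, Ψ x ∂μZ) * Real.exp (R * ∑ i, L i ^ 2 + 2 * 0))) :=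
    ((Real.continuous_exp.tendsto _).comp ((hslim.const_mul 2).const_add _)).const_mul _
  refine (ge_of_tendsto' hlim hN).trans (mul_le_mul_of_nonneg_left (Real.exp_le_exp.2 ?_)
    (Real.exp_pos _).le)
  have : 0 ≤ ∑ i, L i ^ 2 := Finset.sum_nonneg fun i _ => sq_nonneg _
  linarith
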